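/- **Theorem (convergence of SGD with LKH reordering).** *Algorithm.* Let $n\ge 2$ be even, let $f_1,\dots,f_n:\mathbb R^d\to\mathbb R$ be differentiable and $f=\frac1n\sum_{i=1}^n f_i$. Given a step size $\alpha$, a number of epochs $K\ge1$, an initial point $w_1=w^{1}$ and an initial permutation $\pi_1$ of $[n]$, epoch $k\in[K]$ of SGD computes, for $i=1,\dots,n$, $$w^{k+\frac in}=w^{k+\frac{i-1}n}-\alpha\,x_i^k,\qquad x_i^k=\nabla f_{\pi_k(i)}\big(w^{k+\frac{i-1}n}\big),$$ and $w_k:=w^{k}$ denotes the iterate with which epoch $k$ starts. At the end of epoch $k$ the algorithm $\mathrm{LKH}(\delta)$ with $\delta=\frac1{2K}$, run with fresh randomness, selects $n/2$ of the $n$ indices $i$; $\pi_{k+1}$ lists $\pi_k(i)$ for the selected $i$ in increasing order of $i$, followed by $\pi_k(i)$ for the other $i$ in decreasing order of $i$. $\mathrm{LKH}(\delta)$ on points $x_1,\dots,x_n\in\mathbb R^d$ starts from $\psi_0=0\in\mathbb R^d$, $\sigma_0=0$ and performs, for $i=1,\dots,n/2$, with $u_i=x_{2i-1}-x_{2i}$,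 $b_i=\|u_i\|_2$, $\delta_i=\frac{\delta}{2i(\log(n/2)+1)}$, $$a_i=\max\Big(b_i\sigma_{i-1}\sqrt{2\log(2/\delta_i)},\,b_i^2\Big),\qquad \sigma_i^2=\sigma_{i-1}^2+b_i^2\Big(1+\frac{(b_i^2-2a_i)\sigma_{i-1}^2}{a_i^2}\Big)_+ ,$$ the following step: with probability $\min\big(1,\frac12(1-\langle\psi_{i-1},u_i\rangle/a_i)_+\big)$ (which is read as $\frac12$ if $a_i=0$) it selects the index $2i$ and sets $\psi_i=\psi_{i-1}+u_i$; otherwise it selects $2i-1$ and sets $\psi_i=\psi_{i-1}-u_i$. *Rank parameter.* For $\epsilon\ge0$ the $\epsilon$-rank of a matrix is its number of singular values greater than $\epsilon$. For a run of the algorithm put $\bar x^k=\frac1n\sum_{i=1}^n x_i^k$ and $$r=\max_{k\in[K]}\ \epsilon_k\text{-}\mathrm{rank}\big([x_1^k,\dots,x_n^k]\big),\qquad \epsilon_k=\max_{i\in[n]}\frac{\sqrt{9e\log(4Kn\log(en/2))\log(4Kn)}\;\|x_i^k-\bar x^k\|_2}{\sqrt n}.$$ *Assumptions.* Let $L,\sigma,\mu>0$.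 Suppose that $f^\star=\inf_v f(v)>-\infty$ and that, for all $i\in[n]$ and $w,v\in\mathbb R^d$, $$\|\nabla f_i(w)-\nabla f(w)\|_2^2\le\sigma^2,\qquad \|\nabla f_i(w)-\nabla f_i(v)\|_2\le L\|w-v\|_2,\qquad f(w)-f^\star\le\tfrac1{2\mu}\|\nabla f(w)\|_2^2 .$$ *Step size.* Let $F_1=f(w_1)-f^\star$ and let $\rho\ge0$ be an integer (the rank level to which the step size is tuned). Put $$\tilde A=\sqrt{\log\big(4Kn(\log(n/2)+1)\big)\big[e^2\rho+10e\log(4Kn)\big]},\qquad C_3=\frac{(F_1+\sigma^2/L)\mu^2}{224L^2\sigma^2\tilde A^2},\qquad \tilde W=W_0(K^2n^2C_3),$$ where $W_0$ is the principal branch of the Lambert $W$ function, and let $\alpha=\frac{2\tilde W}{Kn\mu}$. Suppose that $K\ge 10+\frac1\mu\,32L(2+\tilde A/n)\tilde W$. *Conclusion.* With probability at least $\frac12$, $$f(w_K)-f^\star\ \le\ C\,\log(nK)^p\,\frac{\max(r,\rho,1)}{n^2K^2}.$$ Here $p$ is an absolute constant and $C$ depends only on $L,\sigma,\mu,F_1$;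 in particular neither depends on $n$, $K$, $d$, $\rho$, the losses $f_i$, $w_1$ or $\pi_1$. -/

import Mathlib

open scoped Gradient

noncomputable section

namespace LKHSGD

/-! ## Linear kernel halving -/

/-- A coin that shows `true` with probability `p`. -/
def coin (p : ℝ) (hp : p ≤ 1) : PMF Bool :=
  PMF.ofFintype (fun b => if b then ENNReal.ofReal p else 1 - ENNReal.ofReal p) (by
    have h : ENNReal.ofReal p ≤ 1 := by simpa using ENNReal.ofReal_le_ofReal hp
    simp [h])

/-- The swapping threshold `𝔞` computed from the current sub-Gaussian constant `σ`, the norm `b` of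
the difference of the two points and the failure probability `δ` of the round. -/
def swapThreshold (σ b δ : ℝ) : ℝ :=
  max (b * σ * √(2 * Real.log (2 / δ))) (b ^ 2)

/-- The updated sub-Gaussian constant. -/
def nextSigma (σ b δ : ℝ) : ℝ :=
  √(σ ^ 2 + b ^ 2 * max 0 (1 + (b ^ 2 - 2 * swapThreshold σ b δ) * σ ^ 2 / swapThreshold σ b δ ^ 2))

/-- The swapping probability `min(1, ½ (1 - α / 𝔞)₊)`. (If `𝔞 = 0` the two points coincide, `α = 0`,
and the value is `1 / 2`.) -/
def swapProb (α a : ℝ) : ℝ := min 1 (1 / 2 * max 0 (1 - α / a))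

/-- The rounds `i, i + 1, …` of linear kernel halving with parameter `δ` on a sequence of `n`
points in total, started from the signed sum `ψ` and the sub-Gaussian constant `σ`, on the points
that have not been processed yet. The output lists, for each of these points in order, whether it
is put into the output coreset. -/
def lkhRounds {d : ℕ} (δ : ℝ) (n : ℕ) :
    ℕ → EuclideanSpace ℝ (Fin d) → ℝ → List (EuclideanSpace ℝ (Fin d)) → PMF (List Bool)
  | i, ψ, σ, x :: x' :: xs =>
    let b : ℝ := ‖x - x'‖
    let δi : ℝ := δ / (2 * i * (Real.log (n / 2) + 1))
    let a : ℝ := swapThreshold σ b δi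
    let α : ℝ := inner ℝ ψ (x - x')
    (coin (swapProb α a) (min_le_left _ _)).bind fun swap =>
      (lkhRounds δ n (i + 1) (ψ + (if swap then (1 : ℝ) else -1) • (x - x'))
        (nextSigma σ b δi) xs).map fun rest => (!swap) :: swap :: rest
  | _, _, _, _ => PMF.pure []

/-- Linear kernel halving `LKH(δ)` on a sequence of points of even length: the random sequence of
indicators of membership in the output coreset, which takes one point of each consecutive pair. -/
def lkh {d : ℕ} (δ : ℝ) (xs : List (EuclideanSpace ℝ (Fin d))) : PMF (List Bool) :=
  lkhRounds δ xs.length 1 0 0 xs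

/-- Thinned reordering: the selected indices in their order, followed by the other indices in
reversed order. -/
def reorder {ι : Type*} (π : List ι) (sel : List Bool) : List ι :=
  ((π.zip sel).filter fun q => q.2).map Prod.fst ++
    (((π.zip sel).filter fun q => !q.2).map Prod.fst).reverse

/-! ## Stochastic gradient descent -/

section SGD

variable {d n : ℕ} (f : Fin n → EuclideanSpace ℝ (Fin d) → ℝ) (α : ℝ)

/-- The empirical risk `(1 / n) ∑ᵢ fᵢ`. -/
def risk (w : EuclideanSpace ℝ (Fin d)) : ℝ := (1 / (n : ℝ)) * ∑ i, f i w

/-- One SGD update with step size `α` on the loss `f i`. -/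
def sgdStep (w : EuclideanSpace ℝ (Fin d)) (i : Fin n) : EuclideanSpace ℝ (Fin d) :=
  w - α • ∇ (f i) w

/-- The iterate after a full epoch that starts at `w` and visits the losses in the order `π`. -/
def sgdEpoch (w : EuclideanSpace ℝ (Fin d)) (π : List (Fin n)) : EuclideanSpace ℝ (Fin d) :=
  π.foldl (sgdStep f α) w

/-- The stochastic gradients that are used during that epoch, in order. -/
def stochGrads : EuclideanSpace ℝ (Fin d) → List (Fin n) → List (EuclideanSpace ℝ (Fin d))
  | _, [] => []
  | w, i :: π => ∇ (f i) w :: stochGrads (sgdStep f α w i) π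

/-- SGD with `LKH(δ)` thinned reordering over `K` epochs, when the first epoch starts from the
iterate `s.1` with the ordering `s.2`: the joint law of the pairs (iterate, ordering) with which
the epochs `1, …, K` start (indexed from `0`). Each epoch uses fresh randomness. -/
def lkhSGD (δ : ℝ) : (K : ℕ) → EuclideanSpace ℝ (Fin d) × List (Fin n) →
    PMF (Fin K → EuclideanSpace ℝ (Fin d) × List (Fin n))
  | 0, _ => PMF.pure Fin.elim0
  | K + 1, s =>
    (lkh δ (stochGrads f α s.1 s.2)).bind fun sel =>
      (lkhSGD δ K (sgdEpoch f α s.1 s.2, reorder s.2 sel)).map fun tr => Fin.cons s tr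

end SGD

/-! ## The rank parameter -/

/-- The `ε`-rank of a real matrix: its number of singular values greater than `ε`, counted with
multiplicity (for `ε ≥ 0`). -/
def epsRank {k l : ℕ} (ε : ℝ) (X : Matrix (Fin k) (Fin l) ℝ) : ℕ :=
  {i : ℕ | ε < (Matrix.toEuclideanLin X).singularValues i}.ncard

/-- The matrix with columns `xs`. -/
def colMatrix {d : ℕ} (xs : List (EuclideanSpace ℝ (Fin d))) :
    Matrix (Fin d) (Fin xs.length) ℝ :=
  Matrix.of fun a i => xs.get i a

/-- The mean of the points `xs`. -/
def mean {d : ℕ} (xs : List (EuclideanSpace ℝ (Fin d))) : EuclideanSpace ℝ (Fin d) :=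
  (1 / (xs.length : ℝ)) • xs.sum

/-- `maxᵢ √(9 e log(4 K n log(e n / 2)) log(4 K n)) ‖xᵢ - x̄‖ / √n` for the `n` points `xs`. -/
def epsLevel {d : ℕ} (K : ℕ) (xs : List (EuclideanSpace ℝ (Fin d))) : ℝ :=
  ⨆ i : Fin xs.length,
    √(9 * Real.exp 1 *
        Real.log (4 * K * xs.length * Real.log (Real.exp 1 * xs.length / 2)) *
        Real.log (4 * K * xs.length)) * ‖xs.get i - mean xs‖ / √xs.length

/-- The rank parameter `r` of a run: the maximum over the epochs `k` of the `ε_k`-rank of the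
matrix of the stochastic gradients of epoch `k`. -/
def rankParam {d n K : ℕ} (f : Fin n → EuclideanSpace ℝ (Fin d) → ℝ) (α : ℝ)
    (tr : Fin K → EuclideanSpace ℝ (Fin d) × List (Fin n)) : ℕ :=
  Finset.univ.sup fun k : Fin K =>
    epsRank (epsLevel K (stochGrads f α (tr k).1 (tr k).2))
      (colMatrix (stochGrads f α (tr k).1 (tr k).2))

/-! ## The step size -/

/-- The principal branch of the Lambert W function: for `x ≥ -1/e`, the largest `y` such that
`y * exp y = x`. -/
def lambertW0 (x : ℝ) : ℝ := sSup {y : ℝ | y * Real.exp y ≤ x}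

/-- The discrepancy constant `Ã` at the rank level `ρ`. -/
def discConst (n K ρ : ℕ) : ℝ :=
  √(Real.log (4 * K * n * (Real.log (n / 2) + 1)) *
      (Real.exp 1 ^ 2 * ρ + 10 * Real.exp 1 * Real.log (4 * K * n)))

/-- `W̃ = W₀(K² n² C₃)` with `C₃ = (F₁ + σ² / L) μ² / (224 L² σ² Ã²)`. -/
def tildeW (L σ μ F₁ : ℝ) (n K ρ : ℕ) : ℝ :=
  lambertW0 ((K : ℝ) ^ 2 * (n : ℝ) ^ 2 *
    ((F₁ + σ ^ 2 / L) * μ ^ 2 / (224 * L ^ 2 * σ ^ 2 * discConst n K ρ ^ 2)))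

/-- The step size `2 W̃ / (K n μ)`. -/
def stepSize (L σ μ F₁ : ℝ) (n K ρ : ℕ) : ℝ :=
  2 * tildeW L σ μ F₁ n K ρ / (K * n * μ)

end LKHSGD

end

/-! The proof follows two quantities from epoch to epoch: the suboptimality, and the prefix
discrepancy of the stochastic gradients (the largest norm of a centred partial sum). An epoch is a
gradient step of length αn for the full risk, with an error governed by the discrepancy. Thinned
reordering halves the discrepancy, up to half the norm of a signed sum ψ of the halving walk
(`norm_sum_prefix_reorder_le`) and a drift term carrying the factor αnL ≤ 1/32
(`discrepancy_next_le`). With the Polyak–Łojasiewicz inequality, suboptimality plus a weighted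
squared discrepancy therefore contracts by 1 - αnμ/2 per epoch, up to an additive noise
(`potential_step`, `suboptimality_le`).

The noise is small because the signed sums are (`lkh_walk_bound`). Each ψ is a combination of the
gradients with coefficients in [-1, 1], so it lies within ε√n of a subspace whose dimension is at
most the ε-rank, and only its coordinates in that subspace need a sub-Gaussian tail bound. This
gives a radius of order log(nK)·√max(r, 1) times the spread, except with probability 1/(2K) per
epoch; a union bound over the epochs leaves probability 1/2.

The tail bound (`lkhRounds_bound`) runs backwards through the rounds. The failure probability as a
function of the current ψ is dominated by a finite sum of exponentials of affine functions, and the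
total Gaussian mass of that sum is what the recursion for σ_i keeps under control.

Finally, the Lambert W step size makes the contracted initial error comparable to the noise
(`rate_le`). -/

namespace LKHSGD

/-! ### Exponential domination of the failure probability of linear kernel halving. -/

open Real

variable {d : ℕ}

/-- Hoeffding's lemma for a biased sign. -/
theorem two_point_exp_le {x : ℝ} (s : ℝ) (hx : |x| ≤ 1) :
    (1 - x) / 2 * exp s + (1 + x) / 2 * exp (-s) ≤ exp (s ^ 2 / 2 - x * s) := by
  obtain ⟨h1, h2⟩ := abs_le.1 hx
  set μ : MeasureTheory.Measure ℝ :=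
    ENNReal.ofReal ((1 - x) / 2) • MeasureTheory.Measure.dirac 1 +
      ENNReal.ofReal ((1 + x) / 2) • MeasureTheory.Measure.dirac (-1) with hμ
  have hprob : MeasureTheory.IsProbabilityMeasure μ := by
    constructor
    simp only [hμ, MeasureTheory.Measure.add_apply, MeasureTheory.Measure.smul_apply,
      MeasureTheory.measure_univ, smul_eq_mul, mul_one]
    rw [← ENNReal.ofReal_add (by linarith) (by linarith)]
    simp [← add_div]
  have hint : ∀ g : ℝ → ℝ, ∫ y, g y ∂μ = (1 - x) / 2 * g 1 + (1 + x) / 2 * g (-1) := by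
    intro g
    have hi : ∀ (c y : ℝ), MeasureTheory.Integrable g
        (ENNReal.ofReal c • MeasureTheory.Measure.dirac y) := fun c y =>
      (MeasureTheory.integrable_dirac (by simp)).smul_measure ENNReal.ofReal_ne_top
    rw [hμ, MeasureTheory.integral_add_measure (hi _ _) (hi _ _),
      MeasureTheory.integral_smul_measure, MeasureTheory.integral_smul_measure,
      MeasureTheory.integral_dirac, MeasureTheory.integral_dirac,
      ENNReal.toReal_ofReal (by linarith), ENNReal.toReal_ofReal (by linarith)]
    rfl
  have hsub := (ProbabilityTheory.hasSubgaussianMGF_of_mem_Icc (X := fun y : ℝ => y) (μ := μ)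
    (a := -1) (b := 1) (by fun_prop) (by
      rw [hμ, MeasureTheory.ae_add_measure_iff]
      constructor <;> refine MeasureTheory.Measure.ae_smul_measure ?_ _ <;>
        simp [MeasureTheory.ae_dirac_eq])).mgf_le s
  rw [ProbabilityTheory.mgf, hint, hint] at hsub
  have e1 : (1 - x) / 2 * exp s + (1 + x) / 2 * exp (-s) =
      exp (- x * s) * ((1 - x) / 2 * exp (s * (1 - ((1 - x) / 2 * 1 + (1 + x) / 2 * -1))) +
        (1 + x) / 2 * exp (s * (-1 - ((1 - x) / 2 * 1 + (1 + x) / 2 * -1)))) := by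
    rw [mul_add, mul_left_comm, mul_left_comm (exp _), ← exp_add, ← exp_add]
    congr 3 <;> ring
  rw [e1]
  refine (mul_le_mul_of_nonneg_left hsub (exp_pos _).le).trans ?_
  rw [← exp_add]
  apply exp_le_exp.2
  norm_num

theorem toOuterMeasure_le_one {β : Type*} (p : PMF β) (s : Set β) : p.toOuterMeasure s ≤ 1 := by
  let : MeasurableSpace β := ⊤
  exact (p.toOuterMeasure_apply_le_toMeasure_apply s).trans MeasureTheory.prob_le_one

theorem toOuterMeasure_coin_bind {β : Type*} {p : ℝ} (hp : p ≤ 1) (g : Bool → PMF β) (s : Set β) :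
    ((coin p hp).bind g).toOuterMeasure s =
      ENNReal.ofReal p * (g true).toOuterMeasure s +
        (1 - ENNReal.ofReal p) * (g false).toOuterMeasure s := by
  rw [PMF.toOuterMeasure_bind_apply, tsum_bool, add_comm]
  simp [coin, PMF.ofFintype_apply]

/-- The signed sums of the pairs of `xs` stay in `P` along the selection `sel`, which takes exactly
one point from each pair. -/
inductive HalvingWalk {E : Type*} [AddCommGroup E] [Module ℝ E] (P : E → Prop) :
    E → List E → List Bool → Prop
  | nil {ψ : E} (h : P ψ) : HalvingWalk P ψ [] []
  | cons {ψ x x' : E} {xs : List E} {sel : List Bool} (s : Bool) (h : P ψ)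
      (hw : HalvingWalk P (ψ + (if s then (1 : ℝ) else -1) • (x - x')) xs sel) :
      HalvingWalk P ψ (x :: x' :: xs) ((!s) :: s :: sel)

/-- A sum of exponentials of affine functions. -/
noncomputable def expSum (l : List (EuclideanSpace ℝ (Fin d) × ℝ)) (ψ : EuclideanSpace ℝ (Fin d)) : ℝ :=
  (l.map fun τ => exp (inner ℝ τ.1 ψ + τ.2)).sum

/-- The expectation of `expSum` for a centred isotropic Gaussian argument of variance `σ²`. -/
noncomputable def expWeight (l : List (EuclideanSpace ℝ (Fin d) × ℝ)) (σ : ℝ) : ℝ :=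
  (l.map fun τ => exp (σ ^ 2 * ‖τ.1‖ ^ 2 / 2 + τ.2)).sum

/-- The effect of one unclipped round on the exponent of an exponential. -/
noncomputable def pullback (u : EuclideanSpace ℝ (Fin d)) (a : ℝ) (τ : EuclideanSpace ℝ (Fin d) × ℝ) :
    EuclideanSpace ℝ (Fin d) × ℝ :=
  (τ.1 - (inner ℝ τ.1 u / a) • u, τ.2 + (inner ℝ τ.1 u) ^ 2 / 2)

theorem expSum_append (l l' : List (EuclideanSpace ℝ (Fin d) × ℝ)) (ψ) :
    expSum (l ++ l') ψ = expSum l ψ + expSum l' ψ := by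
  simp [expSum]

theorem expWeight_append (l l' : List (EuclideanSpace ℝ (Fin d) × ℝ)) (σ) :
    expWeight (l ++ l') σ = expWeight l σ + expWeight l' σ := by
  simp [expWeight]

theorem expSum_nonneg (l : List (EuclideanSpace ℝ (Fin d) × ℝ)) (ψ) : 0 ≤ expSum l ψ := by
  apply List.sum_nonneg
  simp only [List.mem_map]
  rintro _ ⟨_, _, rfl⟩
  positivity

theorem one_le_expSum {l : List (EuclideanSpace ℝ (Fin d) × ℝ)} {ψ} {τ} (hτ : τ ∈ l)
    (h : 0 ≤ inner ℝ τ.1 ψ + τ.2) : 1 ≤ expSum l ψ := by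
  refine (Real.one_le_exp h).trans ?_
  refine List.single_le_sum ?_ _ (List.mem_map_of_mem (f := fun τ => exp (inner ℝ τ.1 ψ + τ.2)) hτ)
  simp only [List.mem_map]
  rintro _ ⟨_, _, rfl⟩
  positivity

theorem nextSigma_sq (σ b δ : ℝ) : nextSigma σ b δ ^ 2 = σ ^ 2 + b ^ 2 *
    max 0 (1 + (b ^ 2 - 2 * swapThreshold σ b δ) * σ ^ 2 / swapThreshold σ b δ ^ 2) := by
  rw [nextSigma, sq_sqrt]
  positivity

/-- This is where the recursion for σ_i comes from. With s = ⟨θ, u⟩, expanding the square gives σ²‖θ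
- (s/a)u‖² + s² = σ²‖θ‖² + s²(1 + (‖u‖² - 2a)σ²/a²), and s² ≤ ‖θ‖²‖u‖² turns the right side into at
most σ_i²‖θ‖². -/
theorem expWeight_pullback_le (l : List (EuclideanSpace ℝ (Fin d) × ℝ))
    (u : EuclideanSpace ℝ (Fin d)) (σ δ : ℝ) :
    expWeight (l.map (pullback u (swapThreshold σ ‖u‖ δ))) σ ≤
      expWeight l (nextSigma σ ‖u‖ δ) := by
  unfold expWeight
  rw [List.map_map]
  apply List.sum_le_sum
  rintro ⟨θ, κ⟩ -
  simp only [Function.comp_apply, pullback]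
  apply exp_le_exp.2
  rw [nextSigma_sq]
  set a := swapThreshold σ ‖u‖ δ
  set s : ℝ := inner ℝ θ u with hs
  have hsb : s ^ 2 ≤ (‖θ‖ * ‖u‖) ^ 2 := by
    rw [← sq_abs]; gcongr; exact abs_real_inner_le_norm θ u
  have hn : ‖θ - (s / a) • u‖ ^ 2 = ‖θ‖ ^ 2 - 2 * (s / a) * s + (s / a) ^ 2 * ‖u‖ ^ 2 := by
    rw [norm_sub_sq_real, inner_smul_right, norm_smul, mul_pow, Real.norm_eq_abs, sq_abs, ← hs]
    ring
  set c := 1 + (‖u‖ ^ 2 - 2 * a) * σ ^ 2 / a ^ 2 with hc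
  have key : σ ^ 2 * ‖θ - (s / a) • u‖ ^ 2 + s ^ 2 = σ ^ 2 * ‖θ‖ ^ 2 + s ^ 2 * c := by
    rw [hn, hc]
    by_cases ha : a = 0
    · simp [ha]
    · field_simp
      ring
  have h2 : s ^ 2 * c ≤ (‖θ‖ * ‖u‖) ^ 2 * max 0 c :=
    (mul_le_mul_of_nonneg_left (le_max_right 0 c) (sq_nonneg s)).trans
      (mul_le_mul_of_nonneg_right hsb (le_max_left 0 c))
  nlinarith

theorem swapProb_of_abs_le {α a : ℝ} (h : |α| ≤ a) : swapProb α a = (1 - α / a) / 2 := by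
  have h1 : |α / a| ≤ 1 := by
    rw [abs_div]
    exact div_le_one_of_le₀ (h.trans (le_abs_self a)) (abs_nonneg _)
  obtain ⟨h1, h2⟩ := abs_le.1 h1
  rw [swapProb, max_eq_right (by linarith), min_eq_right (by linarith)]
  ring

/-- Without clipping the sign has mean -⟨ψ, u⟩/a, so Hoeffding's lemma bounds the average of each
exponential by another exponential of an affine function of ψ, the one given by `pullback`. -/
theorem expSum_step_le (l : List (EuclideanSpace ℝ (Fin d) × ℝ))
    (u ψ : EuclideanSpace ℝ (Fin d)) {a : ℝ} (h : |inner ℝ ψ u| ≤ a) :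
    swapProb (inner ℝ ψ u) a * expSum l (ψ + u) +
      (1 - swapProb (inner ℝ ψ u) a) * expSum l (ψ - u) ≤ expSum (l.map (pullback u a)) ψ := by
  rw [swapProb_of_abs_le h]
  unfold expSum
  rw [List.map_map, ← List.sum_map_mul_left, ← List.sum_map_mul_left, ← List.sum_map_add]
  apply List.sum_le_sum
  rintro ⟨θ, κ⟩ -
  simp only [Function.comp_apply, pullback]
  set x : ℝ := inner ℝ ψ u / a with hx
  have h1 : |x| ≤ 1 := by
    rw [hx, abs_div]
    exact div_le_one_of_le₀ (h.trans (le_abs_self a)) (abs_nonneg _)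
  set s : ℝ := inner ℝ θ u with hs
  have e1 : exp (inner ℝ θ (ψ + u) + κ) = exp (inner ℝ θ ψ + κ) * exp s := by
    rw [inner_add_right, ← exp_add, ← hs]; ring_nf
  have e2 : exp (inner ℝ θ (ψ - u) + κ) = exp (inner ℝ θ ψ + κ) * exp (-s) := by
    rw [inner_sub_right, ← exp_add, ← hs]; ring_nf
  have e3 : exp (inner ℝ (θ - (s / a) • u) ψ + (κ + s ^ 2 / 2)) =
      exp (inner ℝ θ ψ + κ) * exp (s ^ 2 / 2 - x * s) := by
    rw [inner_sub_left, inner_smul_left, ← exp_add, hx, real_inner_comm ψ u]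
    congr 1
    simp
    ring
  rw [e1, e2, e3]
  have := mul_le_mul_of_nonneg_left (two_point_exp_le s h1) (exp_pos (inner ℝ θ ψ + κ)).le
  linarith

/-- A Chernoff bound in functional form: the two exponentials exp(±λ⟨u, ψ⟩ - λa) are at least 1
where clipping occurs, and the threshold a is large enough for each to have mass at most δ/2. -/
theorem exists_clip_expSum (u : EuclideanSpace ℝ (Fin d)) {σ δ : ℝ} (hσ : 0 ≤ σ) (hδ : 0 < δ)
    (hδ2 : δ ≤ 2) : ∃ l : List (EuclideanSpace ℝ (Fin d) × ℝ), expWeight l σ ≤ δ ∧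
      ∀ ψ, swapThreshold σ ‖u‖ δ < |inner ℝ ψ u| → 1 ≤ expSum l ψ := by
  set a := swapThreshold σ ‖u‖ δ with ha
  have hL : 0 ≤ log (2 / δ) := log_nonneg (by rw [le_div_iff₀ hδ]; linarith)
  by_cases hu : u = 0
  · refine ⟨[], by simp [expWeight, hδ.le], fun ψ h => ?_⟩
    exfalso
    have : 0 ≤ a := le_trans (sq_nonneg _) (le_max_right _ _)
    rw [hu, inner_zero_right, abs_zero] at h
    linarith
  have hb : 0 < ‖u‖ := norm_pos_iff.2 hu
  have ha1 : ‖u‖ ^ 2 ≤ a := le_max_right _ _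
  have ha2 : ‖u‖ * σ * √(2 * log (2 / δ)) ≤ a := le_max_left _ _
  -- For σ > 0 this is the usual choice λ = √(2 log(2/δ))/(‖u‖σ). For σ = 0 the quadratic term
  -- vanishes and λ only has to make λa = log(2/δ).
  obtain ⟨lam, hlam, hw⟩ : ∃ lam : ℝ, 0 ≤ lam ∧
      σ ^ 2 * (lam * ‖u‖) ^ 2 / 2 - lam * a ≤ - log (2 / δ) := by
    rcases hσ.eq_or_lt with h0 | h0
    · have : 0 < a := lt_of_lt_of_le (by positivity) ha1
      refine ⟨log (2 / δ) / a, by positivity, ?_⟩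
      rw [← h0]
      simp [div_mul_cancel₀ _ this.ne']
    · refine ⟨√(2 * log (2 / δ)) / (‖u‖ * σ), by positivity, ?_⟩
      have hq : √(2 * log (2 / δ)) ^ 2 = 2 * log (2 / δ) := sq_sqrt (by positivity)
      have e1 : σ ^ 2 * (√(2 * log (2 / δ)) / (‖u‖ * σ) * ‖u‖) ^ 2 = √(2 * log (2 / δ)) ^ 2 := by
        field_simp
      have e2 : 2 * log (2 / δ) ≤ √(2 * log (2 / δ)) / (‖u‖ * σ) * a := by
        refine le_trans (le_of_eq ?_) (mul_le_mul_of_nonneg_left ha2 (by positivity))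
        generalize √(2 * log (2 / δ)) = q at hq
        rw [← hq]
        field_simp
      rw [e1, hq]
      linarith
  refine ⟨[(lam • u, -(lam * a)), (-(lam • u), -(lam * a))], ?_, fun ψ h => ?_⟩
  · have : exp (σ ^ 2 * (lam * ‖u‖) ^ 2 / 2 - lam * a) ≤ δ / 2 := by
      refine (exp_le_exp.2 hw).trans ?_
      rw [exp_neg, exp_log (by positivity), inv_div]
    simp only [expWeight, List.map_cons, List.map_nil, List.sum_cons, List.sum_nil, norm_neg,
      norm_smul, Real.norm_eq_abs, abs_of_nonneg hlam, ← sub_eq_add_neg]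
    linarith
  · rcases lt_abs.1 h with h | h
    · refine one_le_expSum (List.mem_cons_self) ?_
      simp only [inner_smul_left, real_inner_comm ψ u, conj_trivial]
      nlinarith
    · refine one_le_expSum (τ := (-(lam • u), -(lam * a))) (by simp) ?_
      simp only [inner_neg_left, inner_smul_left, real_inner_comm ψ u, conj_trivial]
      nlinarith

/-- The Chernoff bound with the optimal λ = t/S, one exponential for each test direction. -/
theorem exists_exceed_expSum (T : List (EuclideanSpace ℝ (Fin d))) (hT : ∀ θ ∈ T, ‖θ‖ ≤ 1)
    {σ S t : ℝ} (hS : 0 < S) (hσ : σ ^ 2 ≤ S) (ht : 0 ≤ t) :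
    ∃ l : List (EuclideanSpace ℝ (Fin d) × ℝ),
      expWeight l σ ≤ T.length * exp (-(t ^ 2 / (2 * S))) ∧
      ∀ ψ, (¬ ∀ θ ∈ T, inner ℝ θ ψ ≤ t) → 1 ≤ expSum l ψ := by
  refine ⟨T.map fun θ => ((t / S) • θ, -(t * (t / S))), ?_, fun ψ h => ?_⟩
  · rw [expWeight, List.map_map]
    refine (List.sum_le_card_nsmul _ (exp (-(t ^ 2 / (2 * S)))) ?_).trans (by simp)
    simp only [List.mem_map]
    rintro _ ⟨θ, hθ, rfl⟩
    apply exp_le_exp.2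
    simp only [norm_smul, Real.norm_eq_abs, mul_pow, sq_abs]
    have h1 : ‖θ‖ ^ 2 ≤ 1 := pow_le_one₀ (norm_nonneg _) (hT θ hθ)
    have h2 : σ ^ 2 * ((t / S) ^ 2 * ‖θ‖ ^ 2) ≤ S * ((t / S) ^ 2 * 1) := by gcongr
    have e1 : S * ((t / S) ^ 2 * 1) = t ^ 2 / S := by field_simp
    have e2 : t * (t / S) = t ^ 2 / S := by ring
    have e3 : t ^ 2 / (2 * S) = t ^ 2 / S / 2 := by field_simp
    rw [e2, e3]
    linarith
  · push Not at h
    obtain ⟨θ, hθ, h⟩ := h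
    refine one_le_expSum (τ := ((t / S) • θ, -(t * (t / S)))) (List.mem_map_of_mem hθ) ?_
    simp only [inner_smul_left, conj_trivial]
    have : 0 ≤ t / S := by positivity
    nlinarith

/-- The sub-Gaussian constant does not accumulate over the rounds. Since b² ≤ a, the bracket in the
update is at most 1 - σ²/a, so σ can grow only while σ² < a; by the form of a this forces σ² ≤ 2
log(2/δ) b², and one round adds at most b². -/
theorem nextSigma_sq_le {σ b δ S : ℝ} (hσ : σ ^ 2 ≤ S) (hL : 1 ≤ 2 * log (2 / δ))
    (hS : (2 * log (2 / δ) + 1) * b ^ 2 ≤ S) : nextSigma σ b δ ^ 2 ≤ S := by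
  rw [nextSigma_sq]
  set a := swapThreshold σ b δ with ha
  have hab : b ^ 2 ≤ a := le_max_right _ _
  by_cases ha0 : a = 0
  · have : b ^ 2 = 0 := le_antisymm (ha0 ▸ hab) (sq_nonneg b)
    simp [this, hσ]
  have hapos : 0 < a := lt_of_le_of_ne ((sq_nonneg b).trans hab) (Ne.symm ha0)
  have hinc : (b ^ 2 - 2 * a) * σ ^ 2 / a ^ 2 ≤ - (σ ^ 2 / a) := by
    rw [div_le_iff₀ (by positivity)]
    have : - (σ ^ 2 / a) * a ^ 2 = - a * σ ^ 2 := by field_simp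
    rw [this]
    exact mul_le_mul_of_nonneg_right (by linarith) (sq_nonneg σ)
  by_cases hc : a ≤ σ ^ 2
  · have : 1 ≤ σ ^ 2 / a := by rwa [one_le_div hapos]
    rw [max_eq_left (by linarith)]
    simpa using hσ
  · push Not at hc
    have h1 : max 0 (1 + (b ^ 2 - 2 * a) * σ ^ 2 / a ^ 2) ≤ 1 := by
      apply max_le zero_le_one
      have : 0 ≤ σ ^ 2 / a := by positivity
      linarith
    have h2 : σ ^ 2 ≤ 2 * log (2 / δ) * b ^ 2 := by
      rcases le_total (b * σ * √(2 * log (2 / δ))) (b ^ 2) with h | h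
      · have : a = b ^ 2 := max_eq_right h
        nlinarith [sq_nonneg b]
      · have e : a = b * σ * √(2 * log (2 / δ)) := max_eq_left h
        have e2 : a ^ 2 = σ ^ 2 * (2 * log (2 / δ) * b ^ 2) := by
          rw [e, mul_pow, sq_sqrt (by linarith)]; ring
        by_contra hcon
        push Not at hcon
        have : a ^ 2 ≤ σ ^ 2 * σ ^ 2 := by rw [e2]; gcongr
        nlinarith
    have h3 := mul_le_mul_of_nonneg_left h1 (sq_nonneg b)
    linarith

/-- The failure probability of round `i`. -/
noncomputable def roundFailure (δ : ℝ) (n i : ℕ) : ℝ := δ / (2 * i * (log (n / 2) + 1))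

/-- Backward induction. The constants σ_i depend on the points and not on the coins, so one list of
exponentials serves all ψ. Each round pulls back the list of the remaining rounds and appends
exponentials for clipping and for leaving the region; at ψ = 0, σ = 0 the sum equals its mass. The
factor `xs.length / 2 + 1` counts the states of the walk, both endpoints included. -/
theorem lkhRounds_bound {δ : ℝ} {n : ℕ} (hδ : 0 < δ) (hδ1 : δ ≤ 1) (hn : 2 ≤ n)
    (T : List (EuclideanSpace ℝ (Fin d))) (hT : ∀ θ ∈ T, ‖θ‖ ≤ 1) {S t B : ℝ} (hS : 0 < S)
    (ht : 0 ≤ t) :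
    ∀ (xs : List (EuclideanSpace ℝ (Fin d))) (i : ℕ) (σ : ℝ), Even xs.length → 1 ≤ i → 0 ≤ σ →
      σ ^ 2 ≤ S → (∀ x ∈ xs, ∀ y ∈ xs, ‖x - y‖ ≤ B) →
      (∀ j < i + xs.length / 2, i ≤ j → (2 * log (2 / roundFailure δ n j) + 1) * B ^ 2 ≤ S) →
      ∃ l : List (EuclideanSpace ℝ (Fin d) × ℝ),
        expWeight l σ ≤ ∑ j ∈ Finset.range (xs.length / 2), roundFailure δ n (i + j) +
          ((xs.length / 2 : ℕ) + 1) * (T.length * exp (-(t ^ 2 / (2 * S)))) ∧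
        ∀ ψ, (lkhRounds δ n i ψ σ xs).toOuterMeasure
            {sel | ¬ HalvingWalk (fun ψ => ∀ θ ∈ T, inner ℝ θ ψ ≤ t) ψ xs sel} ≤
          ENNReal.ofReal (expSum l ψ)
  | [], i, σ, _, _, _, hσ, _, _ => by
    obtain ⟨l, hl, hl'⟩ := exists_exceed_expSum T hT hS hσ ht
    refine ⟨l, by simpa using hl, fun ψ => ?_⟩
    by_cases h : ∀ θ ∈ T, inner ℝ θ ψ ≤ t
    · rw [lkhRounds, PMF.toOuterMeasure_pure_apply, if_neg]
      · exact zero_le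
      · simpa using HalvingWalk.nil (P := fun ψ => ∀ θ ∈ T, inner ℝ θ ψ ≤ t) h
      · simp
    · refine (toOuterMeasure_le_one _ _).trans ?_
      simpa using hl' ψ h
  | [x], _, _, h, _, _, _, _, _ => by simp at h
  | x :: x' :: xs, i, σ, hlen, hi, hσ0, hσ, hB, hlog => by
    have hlen2 : (x :: x' :: xs).length / 2 = xs.length / 2 + 1 := by
      simp only [List.length_cons]
      omega
    have hi' : (1 : ℝ) ≤ i := by exact_mod_cast hi
    have hlogn : 0 ≤ log (n / 2) := by
      apply log_nonneg
      rw [le_div_iff₀ two_pos, one_mul]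
      exact_mod_cast hn
    set δi := roundFailure δ n i with hδi
    have hδi0 : 0 < δi := by
      rw [hδi, roundFailure]
      positivity
    have hδi1 : δi ≤ 1 := by
      rw [hδi, roundFailure]
      apply div_le_one_of_le₀ _ (by positivity)
      nlinarith
    have hL : 1 ≤ 2 * log (2 / δi) := by
      have : log 2 ≤ log (2 / δi) := log_le_log two_pos (by rw [le_div_iff₀ hδi0]; linarith)
      linarith [log_two_gt_d9]
    have hb : ‖x - x'‖ ≤ B := hB x (by simp) x' (by simp)
    have hσ' : nextSigma σ ‖x - x'‖ δi ^ 2 ≤ S := by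
      refine nextSigma_sq_le hσ hL (le_trans ?_ (hlog i (by omega) le_rfl))
      have : ‖x - x'‖ ^ 2 ≤ B ^ 2 := pow_le_pow_left₀ (norm_nonneg _) hb 2
      exact mul_le_mul_of_nonneg_left this (by linarith)
    obtain ⟨l, hl, hl'⟩ := lkhRounds_bound hδ hδ1 hn T hT hS ht xs (i + 1)
      (nextSigma σ ‖x - x'‖ δi) (by simpa [Nat.even_add_one] using hlen) (by omega)
      (sqrt_nonneg _) hσ'
      (fun y hy z hz => hB y (by simp [hy]) z (by simp [hz]))
      (fun j hj hij => hlog j (by omega) (by omega))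
    obtain ⟨lt, hlt, hlt'⟩ := exists_exceed_expSum T hT hS hσ ht
    obtain ⟨lc, hlc, hlc'⟩ := exists_clip_expSum (x - x') hσ0 hδi0 (by linarith)
    refine ⟨l.map (pullback (x - x') (swapThreshold σ ‖x - x'‖ δi)) ++ (lc ++ lt), ?_, fun ψ => ?_⟩
    · rw [expWeight_append, expWeight_append, hlen2, Finset.sum_range_succ', add_zero]
      have h1 := (expWeight_pullback_le l (x - x') σ δi).trans hl
      have h2 : ∀ j, i + 1 + j = i + (j + 1) := fun j => by ring
      simp only [h2] at h1
      push_cast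
      linarith
    · rw [expSum_append, expSum_append]
      have p1 := expSum_nonneg (l.map (pullback (x - x') (swapThreshold σ ‖x - x'‖ δi))) ψ
      have p2 := expSum_nonneg lc ψ
      have p3 := expSum_nonneg lt ψ
      -- If ψ has left the region, or if the round is clipped, the appended exponentials already
      -- exceed 1 and no estimate is needed. Otherwise the round is unclipped and `expSum_step_le`
      -- applies.
      by_cases hP : ∀ θ ∈ T, inner ℝ θ ψ ≤ t
      swap
      · refine (toOuterMeasure_le_one _ _).trans (ENNReal.one_le_ofReal.2 ?_)
        linarith [hlt' ψ hP]
      by_cases hclip : swapThreshold σ ‖x - x'‖ δi < |inner ℝ ψ (x - x')|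
      · refine (toOuterMeasure_le_one _ _).trans (ENNReal.one_le_ofReal.2 ?_)
        linarith [hlc' ψ hclip]
      push Not at hclip
      have hstep := expSum_step_le l (x - x') ψ hclip
      refine le_trans ?_ (ENNReal.ofReal_le_ofReal
        (hstep.trans (by linarith : _ ≤ expSum (l.map (pullback (x - x')
          (swapThreshold σ ‖x - x'‖ δi))) ψ + (expSum lc ψ + expSum lt ψ))))
      have hp0 : 0 ≤ swapProb (inner ℝ ψ (x - x')) (swapThreshold σ ‖x - x'‖ δi) := by
        rw [swapProb]; positivity
      have hp1 : swapProb (inner ℝ ψ (x - x')) (swapThreshold σ ‖x - x'‖ δi) ≤ 1 :=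
        min_le_left _ _
      have hcoin := toOuterMeasure_coin_bind hp1 (fun swap =>
        (lkhRounds δ n (i + 1) (ψ + (if swap then (1 : ℝ) else -1) • (x - x'))
          (nextSigma σ ‖x - x'‖ δi) xs).map fun rest => (!swap) :: swap :: rest)
        {sel | ¬ HalvingWalk (fun ψ => ∀ θ ∈ T, inner ℝ θ ψ ≤ t) ψ (x :: x' :: xs) sel}
      have hrec : ∀ swap : Bool, ((lkhRounds δ n (i + 1)
          (ψ + (if swap then (1 : ℝ) else -1) • (x - x'))
          (nextSigma σ ‖x - x'‖ δi) xs).map fun rest => (!swap) :: swap :: rest).toOuterMeasure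
          {sel | ¬ HalvingWalk (fun ψ => ∀ θ ∈ T, inner ℝ θ ψ ≤ t) ψ (x :: x' :: xs) sel} ≤
          ENNReal.ofReal (expSum l (ψ + (if swap then (1 : ℝ) else -1) • (x - x'))) := by
        intro swap
        rw [PMF.toOuterMeasure_map_apply]
        refine le_trans (MeasureTheory.measure_mono ?_) (hl' _)
        intro rest hrest hw
        exact hrest (HalvingWalk.cons swap hP hw)
      rw [lkhRounds]
      refine hcoin.le.trans ?_
      rw [ENNReal.ofReal_add (mul_nonneg hp0 (expSum_nonneg _ _))
        (mul_nonneg (by linarith) (expSum_nonneg _ _)), ENNReal.ofReal_mul hp0,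
        ENNReal.ofReal_mul (by linarith), ENNReal.ofReal_sub _ hp0, ENNReal.ofReal_one]
      have ht := hrec true
      have hf := hrec false
      simp only [if_true, one_smul, Bool.false_eq_true, if_false, neg_smul, ← sub_eq_add_neg]
        at ht hf ⊢
      gcongr

end LKHSGD

/-! ### Low-dimensional approximation from the ε-rank, and coefficients of the signed sums. -/

namespace LKHSGD

open Real Module

variable {d : ℕ}

/-- V is spanned by the images of the right singular vectors indexed by I. The remaining images are
orthogonal with norms at most ε, so Parseval bounds the residual. -/
theorem exists_submodule_of_orthonormalBasis {E F : Type*} [NormedAddCommGroup E]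
    [InnerProductSpace ℝ E] [FiniteDimensional ℝ E] [NormedAddCommGroup F] [InnerProductSpace ℝ F]
    [FiniteDimensional ℝ F] (T : E →ₗ[ℝ] F) {l : ℕ} (b : OrthonormalBasis (Fin l) ℝ E)
    (q : Fin l → ℝ) (hq : ∀ i, 0 ≤ q i)
    (hb : ∀ i, (LinearMap.adjoint T ∘ₗ T) (b i) = (q i) ^ 2 • b i) {ε : ℝ} (hε : 0 ≤ ε)
    (I : Finset (Fin l)) (hI : ∀ i ∉ I, q i ≤ ε) :
    ∃ V : Submodule ℝ F, finrank ℝ V ≤ I.card ∧ ∀ s, ∃ v ∈ V, ‖T s - v‖ ≤ ε * ‖s‖ := by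
  classical
  have hrank := finrank_span_finset_le_card (R := ℝ) (I.image fun i => T (b i))
  refine ⟨_, le_trans hrank Finset.card_image_le, fun s => ?_⟩
  set c : Fin l → ℝ := fun i => inner ℝ (b i) s with hc
  have hs : s = ∑ i, c i • b i := (b.sum_repr' s).symm
  refine ⟨∑ i ∈ I, c i • T (b i), Submodule.sum_mem _ fun i hi => Submodule.smul_mem _ _
    (Submodule.subset_span (Finset.mem_coe.2 (Finset.mem_image_of_mem _ hi))), ?_⟩
  have hdiff : T s - ∑ i ∈ I, c i • T (b i) = T (∑ i ∈ Iᶜ, c i • b i) := by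
    conv_lhs => rw [hs]
    rw [map_sum, map_sum, ← Finset.sum_add_sum_compl I]
    simp
  have hTT : ∀ w, ‖T w‖ ^ 2 = inner ℝ w ((LinearMap.adjoint T ∘ₗ T) w) := by
    intro w
    rw [LinearMap.comp_apply, LinearMap.adjoint_inner_right, real_inner_self_eq_norm_sq]
  have hnorm : ‖T (∑ i ∈ Iᶜ, c i • b i)‖ ^ 2 = ∑ i ∈ Iᶜ, c i ^ 2 * (q i) ^ 2 := by
    have h2 : (LinearMap.adjoint T ∘ₗ T) (∑ i ∈ Iᶜ, c i • b i) =
        ∑ i ∈ Iᶜ, (c i * (q i) ^ 2) • b i := by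
      rw [map_sum]
      refine Finset.sum_congr rfl fun i _ => ?_
      rw [map_smul, hb, smul_smul]
    rw [hTT, h2, b.orthonormal.inner_sum]
    refine Finset.sum_congr rfl fun i _ => ?_
    simp only [conj_trivial]
    ring
  rw [hdiff]
  refine abs_le_of_sq_le_sq' ?_ (by positivity) |>.2
  rw [hnorm, mul_pow, ← b.sum_sq_norm_inner_right s, Finset.mul_sum]
  calc ∑ i ∈ Iᶜ, c i ^ 2 * (q i) ^ 2 ≤ ∑ i ∈ Iᶜ, ε ^ 2 * ‖inner ℝ (b i) s‖ ^ 2 := by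
        refine Finset.sum_le_sum fun i hi => ?_
        have h2 : q i ^ 2 ≤ ε ^ 2 := pow_le_pow_left₀ (hq i) (hI i (Finset.mem_compl.1 hi)) 2
        rw [Real.norm_eq_abs, sq_abs, mul_comm]
        exact mul_le_mul_of_nonneg_right h2 (sq_nonneg _)
    _ ≤ ∑ i, ε ^ 2 * ‖inner ℝ (b i) s‖ ^ 2 :=
        Finset.sum_le_sum_of_subset_of_nonneg (Finset.subset_univ _)
          fun _ _ _ => by positivity

theorem exists_submodule_of_singularValues {E F : Type*} [NormedAddCommGroup E]
    [InnerProductSpace ℝ E] [FiniteDimensional ℝ E] [NormedAddCommGroup F] [InnerProductSpace ℝ F]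
    [FiniteDimensional ℝ F] (T : E →ₗ[ℝ] F) {l : ℕ} (hn : finrank ℝ E = l) {ε : ℝ}
    (hε : 0 ≤ ε) : ∃ V : Submodule ℝ F,
      finrank ℝ V ≤ {i : ℕ | ε < T.singularValues i}.ncard ∧ finrank ℝ V ≤ l ∧
      ∀ s, ∃ v ∈ V, ‖T s - v‖ ≤ ε * ‖s‖ := by
  classical
  set q : Fin l → ℝ := fun i => T.singularValues i with hq
  set I : Finset (Fin l) := Finset.univ.filter fun i => ε < q i with hI
  obtain ⟨V, hV, hV'⟩ := exists_submodule_of_orthonormalBasis T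
    (T.isSymmetric_adjoint_comp_self.eigenvectorBasis hn) q
    (fun i => T.singularValues_nonneg i) (fun i => by
      rw [T.isSymmetric_adjoint_comp_self.apply_eigenvectorBasis hn, hq,
        T.sq_singularValues_fin hn]
      rfl) hε I (fun i hi => by simpa [hI] using hi)
  refine ⟨V, hV.trans ?_, hV.trans ((Finset.card_le_univ I).trans (by simp)), hV'⟩
  rw [← Finset.card_map Fin.valEmbedding, ← Set.ncard_coe_finset]
  refine Set.ncard_le_ncard ?_ ((Set.finite_Iio l).subset ?_)
  · intro i hi
    simp only [Finset.coe_map, Set.mem_image, Finset.mem_coe, hI, Finset.mem_filter] at hi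
    obtain ⟨j, hj, rfl⟩ := hi
    exact hj.2
  · intro i hi
    by_contra hil
    -- Singular values are indexed by all natural numbers and vanish beyond the dimension. As ε ≥ 0,
    -- the set counted by `ncard` is finite, so `ncard` is not its default value 0.
    have : T.singularValues i = 0 :=
      T.singularValues_of_finrank_le (by rw [hn]; simpa using hil)
    simp only [Set.mem_ofPred_eq, this] at hi
    linarith

theorem exists_submodule_of_epsRank {k l : ℕ} (X : Matrix (Fin k) (Fin l) ℝ) {ε : ℝ}
    (hε : 0 ≤ ε) : ∃ V : Submodule ℝ (EuclideanSpace ℝ (Fin k)),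
      finrank ℝ V ≤ epsRank ε X ∧ finrank ℝ V ≤ l ∧
      ∀ s, ∃ v ∈ V, ‖Matrix.toEuclideanLin X s - v‖ ≤ ε * ‖s‖ :=
  exists_submodule_of_singularValues _ (by simp) hε

namespace HalvingWalk

variable {E : Type*} [NormedAddCommGroup E] [NormedSpace ℝ E]

theorem mono {P Q : E → Prop} {ψ : E} {xs : List E} {sel : List Bool}
    (h : HalvingWalk P ψ xs sel) (hPQ : ∀ ψ, P ψ → Q ψ) : HalvingWalk Q ψ xs sel := by
  induction h with
  | nil h => exact .nil (hPQ _ h)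
  | cons s h _ ih => exact .cons s (hPQ _ h) ih

/-- Each point enters a signed sum with coefficient 1, -1 or 0. Hence ψ' - ψ is the image under the
data matrix of a vector of norm at most √n, which is what the approximation by V requires. -/
theorem exists_coeff {P : E → Prop} {ψ : E} {xs : List E} {sel : List Bool} {B : ℝ}
    (h : HalvingWalk P ψ xs sel) (hB : ∀ x ∈ xs, ∀ y ∈ xs, ‖x - y‖ ≤ B) :
    HalvingWalk (fun ψ' => P ψ' ∧ ‖ψ' - ψ‖ ≤ xs.length / 2 * B ∧
      ∃ s : Fin xs.length → ℝ, (∀ i, |s i| ≤ 1) ∧ ψ' = ψ + ∑ i, s i • xs.get i) ψ xs sel := by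
  induction h with
  | nil h => exact .nil ⟨h, by simp, fun _ => 0, by simp, by simp⟩
  | @cons ψ x x' xs sel s h _ ih =>
    have hB0 : 0 ≤ B := (norm_nonneg _).trans (hB x (by simp) x' (by simp))
    refine .cons s ⟨h, by simpa using by positivity, fun _ => 0, by simp, by simp⟩ ?_
    refine (ih fun y hy z hz => hB y (by simp [hy]) z (by simp [hz])).mono ?_
    rintro ψ' ⟨hP, hn, c, hc, hψ'⟩
    refine ⟨hP, ?_, Fin.cons (if s then (1 : ℝ) else -1)
      (Fin.cons (-(if s then (1 : ℝ) else -1)) c), ?_, ?_⟩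
    · have h1 : ‖(if s then (1 : ℝ) else -1) • (x - x')‖ ≤ B := by
        have := hB x (by simp) x' (by simp)
        cases s <;> simpa [norm_smul, norm_sub_rev] using this
      have h2 : ψ' - ψ = (ψ' - (ψ + (if s then (1 : ℝ) else -1) • (x - x'))) +
        (if s then (1 : ℝ) else -1) • (x - x') := by abel
      rw [h2]
      refine (norm_add_le _ _).trans ?_
      simp only [List.length_cons]
      push_cast
      linarith
    · intro i
      refine Fin.cases ?_ (fun i => Fin.cases ?_ (fun i => ?_) i) i
      · cases s <;> simp
      · cases s <;> simp
      · simpa using hc i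
    · have e1 : ∑ i : Fin (x :: x' :: xs).length, (Fin.cons (if s then (1 : ℝ) else -1)
          (Fin.cons (-(if s then (1 : ℝ) else -1)) c) : Fin (xs.length + 1 + 1) → ℝ) i •
            (x :: x' :: xs).get i = (if s then (1 : ℝ) else -1) • x +
            (-(if s then (1 : ℝ) else -1) • x' + ∑ i, c i • xs.get i) := by
        simp only [List.length_cons]
        rw [Fin.sum_univ_succ, Fin.sum_univ_succ]
        rfl
      rw [hψ', e1, smul_sub, neg_smul]
      abel

end HalvingWalk

end LKHSGD

/-! ### Norm bound for the signed sums of one halving run. -/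

namespace LKHSGD

open Real Module

variable {d : ℕ}

theorem toEuclideanLin_colMatrix (xs : List (EuclideanSpace ℝ (Fin d))) (s : Fin xs.length → ℝ) :
    Matrix.toEuclideanLin (colMatrix xs) (WithLp.toLp 2 s) = ∑ i, s i • xs.get i := by
  ext a
  simp [Matrix.toLpLin_apply, Matrix.mulVec, dotProduct, colMatrix, mul_comm]

theorem norm_toLp_le_sqrt {m : ℕ} {s : Fin m → ℝ} (hs : ∀ i, |s i| ≤ 1) :
    ‖(WithLp.toLp 2 s : EuclideanSpace ℝ (Fin m))‖ ≤ √m := by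
  rw [EuclideanSpace.norm_eq]
  apply sqrt_le_sqrt
  refine (Finset.sum_le_sum (g := fun _ => (1 : ℝ)) fun i _ => ?_).trans (by simp)
  exact pow_le_one₀ (norm_nonneg _) (hs i)

/-- Vectors with small inner products against an orthonormal basis of `V` that lie close to `V`
are short. -/
theorem norm_le_of_inner_le {F : Type*} [NormedAddCommGroup F] [InnerProductSpace ℝ F]
    [FiniteDimensional ℝ F] (V : Submodule ℝ F) {r : ℕ} (e : OrthonormalBasis (Fin r) ℝ V)
    {ψ v : F} (hv : v ∈ V) {t η : ℝ} (h : ∀ i, |inner ℝ (e i : F) ψ| ≤ t)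
    (hη : ‖ψ - v‖ ≤ η) : ‖ψ‖ ≤ √(r * t ^ 2) + η := by
  have h1 : ‖ψ - V.starProjection ψ‖ ≤ ‖ψ - v‖ := by
    rw [Submodule.starProjection_minimal]
    exact ciInf_le (f := fun x : V => ‖ψ - x‖) ⟨0, by rintro _ ⟨x, rfl⟩; positivity⟩ ⟨v, hv⟩
  have h2 : ‖V.starProjection ψ‖ ≤ √(r * t ^ 2) := by
    apply le_sqrt_of_sq_le
    rw [Submodule.starProjection_apply, ← Submodule.coe_norm, ← e.sum_sq_norm_inner_right]
    refine (Finset.sum_le_sum (g := fun _ => t ^ 2) fun i _ => ?_).trans (by simp)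
    rw [Submodule.inner_orthogonalProjectionOnto_eq_of_mem_left]
    exact pow_le_pow_left₀ (norm_nonneg _) (h i) 2
  have h3 : ψ = V.starProjection ψ + (ψ - V.starProjection ψ) := by abel
  rw [h3]
  exact (norm_add_le _ _).trans (add_le_add h2 (h1.trans hη))

theorem sum_roundFailure_le {δ : ℝ} {n : ℕ} (hδ : 0 < δ) (hn : 2 ≤ n) :
    ∑ j ∈ Finset.range (n / 2), roundFailure δ n (1 + j) ≤ δ / 2 := by
  have hlog : 0 ≤ log (n / 2) := log_nonneg (by
    rw [le_div_iff₀ two_pos, one_mul]; exact_mod_cast hn)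
  have hh : ((harmonic (n / 2) : ℚ) : ℝ) ≤ log (n / 2) + 1 := by
    refine (harmonic_le_one_add_log _).trans ?_
    have h0 : (0 : ℝ) < (n / 2 : ℕ) := by exact_mod_cast Nat.div_pos hn two_pos
    have := log_le_log h0 (Nat.cast_div_le (m := n) (n := 2) (α := ℝ))
    push_cast at this
    linarith
  have e : ∑ j ∈ Finset.range (n / 2), roundFailure δ n (1 + j) =
      δ / (2 * (log (n / 2) + 1)) * ((harmonic (n / 2) : ℚ) : ℝ) := by
    rw [harmonic]
    push_cast
    rw [Finset.mul_sum]
    refine Finset.sum_congr rfl fun j _ => ?_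
    rw [roundFailure]
    push_cast
    field_simp
    ring
  rw [e]
  refine (mul_le_mul_of_nonneg_left hh (by positivity)).trans (le_of_eq ?_)
  field_simp

/-- The bound on the signed sums of linear kernel halving, relative to the radius of the points. -/
noncomputable def walkRadius (n K r : ℕ) : ℝ :=
  min n √(1440 * log (n * K) ^ 2 * (max r 1 : ℕ))

theorem walkRadius_nonneg (n K r : ℕ) : 0 ≤ walkRadius n K r :=
  le_min (Nat.cast_nonneg n) (sqrt_nonneg _)

theorem epsLevel_nonneg (K : ℕ) (xs : List (EuclideanSpace ℝ (Fin d))) : 0 ≤ epsLevel K xs :=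
  Real.iSup_nonneg fun _ => by positivity

theorem log_div_two_add_one_le {n : ℕ} (hn : 2 ≤ n) : log (n / 2) + 1 ≤ n / 2 := by
  have : (0 : ℝ) < n / 2 := by
    have : (2 : ℝ) ≤ n := by exact_mod_cast hn
    linarith
  linarith [log_le_sub_one_of_pos this]

theorem log_const_mul_le {n K : ℕ} {x : ℝ} (hx : 0 < x) (hn : 2 ≤ n) (hK : 1 ≤ K)
    (hlog : 2 ≤ log (n * K)) (hxn : x ≤ 8 * (K * (n : ℝ) ^ 2)) : log x ≤ 4 * log (n * K) := by
  have h1 : (1 : ℝ) ≤ K := by exact_mod_cast hK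
  have h2 : (2 : ℝ) ≤ n := by exact_mod_cast hn
  have e8 : log 8 ≤ 3 := by
    have : log (8 : ℝ) = 3 * log 2 := by
      rw [show (8 : ℝ) = 2 ^ 3 by norm_num, log_pow]; norm_num
    linarith [log_two_lt_d9]
  have h3 : 8 * (K * (n : ℝ) ^ 2) ≤ 8 * (n * K) ^ 2 := by
    nlinarith [mul_le_mul_of_nonneg_right h1 (by positivity : (0:ℝ) ≤ K * (n : ℝ) ^ 2)]
  have h4 : log x ≤ log (8 * (n * K) ^ 2) := log_le_log hx (hxn.trans h3)
  rw [log_mul (by norm_num) (by positivity), log_pow] at h4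
  push_cast at h4
  linarith

/-- Both logarithms in the level are at most 4 log(nK), and 9e · 16 ≤ 392. -/
theorem epsLevel_mul_sqrt_le {K : ℕ} {xs : List (EuclideanSpace ℝ (Fin d))} (hK : 1 ≤ K)
    (hn : 2 ≤ xs.length) (hlog : 2 ≤ log (xs.length * K)) {M : ℝ} (hM0 : 0 ≤ M)
    (hM : ∀ i, ‖xs.get i - mean xs‖ ≤ M) :
    epsLevel K xs * √xs.length ≤ √(392 * log (xs.length * K) ^ 2) * M := by
  set n := xs.length with hndef
  have h1 : (1 : ℝ) ≤ K := by exact_mod_cast hK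
  have h2 : (2 : ℝ) ≤ n := by exact_mod_cast hn
  have hpos : 0 < √(n : ℝ) := sqrt_pos.2 (by linarith)
  have hle : log (n / 2) + 1 ≤ n / 2 := log_div_two_add_one_le hn
  have hlog0 : 0 ≤ log ((n : ℝ) / 2) := log_nonneg (by linarith)
  have e1 : log (exp 1 * n / 2) = log (n / 2) + 1 := by
    rw [mul_div_assoc, log_mul (exp_pos 1).ne' (by positivity), log_exp, add_comm]
  have hKn : 1 ≤ 4 * (K : ℝ) * n := by nlinarith
  have l1 : log (4 * K * n * log (exp 1 * n / 2)) ≤ 4 * log (n * K) := by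
    rw [e1]
    refine log_const_mul_le (by positivity) hn hK hlog ?_
    have := mul_le_mul_of_nonneg_left hle (by positivity : (0 : ℝ) ≤ 4 * K * n)
    have : (0 : ℝ) ≤ K * (n : ℝ) ^ 2 := by positivity
    nlinarith
  have l2 : log (4 * K * n) ≤ 4 * log (n * K) := by
    refine log_const_mul_le (by positivity) hn hK hlog ?_
    nlinarith [mul_nonneg (by positivity : (0 : ℝ) ≤ K * n) (by linarith : (0 : ℝ) ≤ n - 1)]
  have l20 : 0 ≤ log (4 * K * n) := log_nonneg hKn
  have hc : √(9 * exp 1 * log (4 * K * n * log (exp 1 * n / 2)) * log (4 * K * n)) ≤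
      √(392 * log (n * K) ^ 2) := by
    apply sqrt_le_sqrt
    have := mul_le_mul l1 l2 l20 (by linarith)
    have he := exp_one_lt_d9
    have hsq : 0 ≤ log ((n : ℝ) * K) ^ 2 := sq_nonneg _
    calc 9 * exp 1 * log (4 * K * n * log (exp 1 * n / 2)) * log (4 * K * n) =
          9 * exp 1 * (log (4 * K * n * log (exp 1 * n / 2)) * log (4 * K * n)) := by ring
      _ ≤ 9 * exp 1 * (4 * log (n * K) * (4 * log (n * K))) := by gcongr
      _ = 144 * exp 1 * log (n * K) ^ 2 := by ring
      _ ≤ 392 * log (n * K) ^ 2 := by gcongr; linarith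
  rw [← le_div_iff₀ hpos]
  refine Real.iSup_le (fun i => ?_) (by positivity)
  gcongr
  exact hM i

/-- The test directions are ± an orthonormal basis of the approximating subspace V. The triangle
inequality over n/2 steps of length at most 2M gives the alternative bound nM in `walkRadius`. -/
theorem lkh_walk_bound {K : ℕ} (hK : 1 ≤ K) (xs : List (EuclideanSpace ℝ (Fin d)))
    (heven : Even xs.length) (hn : 2 ≤ xs.length) (hlog : 2 ≤ log (xs.length * K)) {M : ℝ}
    (hM0 : 0 < M) (hM : ∀ i, ‖xs.get i - mean xs‖ ≤ M) :
    (lkh (1 / (2 * (K : ℝ))) xs).toOuterMeasure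
      {sel | ¬ HalvingWalk (fun ψ => ‖ψ‖ ≤
        walkRadius xs.length K (epsRank (epsLevel K xs) (colMatrix xs)) * M) 0 xs sel} ≤
      ENNReal.ofReal (1 / (2 * (K : ℝ))) := by
  obtain ⟨V, hVr, hVn, hV⟩ := exists_submodule_of_epsRank (colMatrix xs) (epsLevel_nonneg K xs)
  set n := xs.length with hndef
  set r := epsRank (epsLevel K xs) (colMatrix xs) with hr
  set r' := finrank ℝ V with hr'
  have h1 : (1 : ℝ) ≤ K := by exact_mod_cast hK
  have h2 : (2 : ℝ) ≤ n := by exact_mod_cast hn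
  have e : OrthonormalBasis (Fin r') ℝ V := stdOrthonormalBasis ℝ V
  set T : List (EuclideanSpace ℝ (Fin d)) := (List.ofFn fun i => (e i : EuclideanSpace ℝ (Fin d)))
    ++ (List.ofFn fun i => -(e i : EuclideanSpace ℝ (Fin d))) with hT
  have hTn : ∀ θ ∈ T, ‖θ‖ ≤ 1 := by
    intro θ hθ
    have he : ∀ i, ‖(e i : EuclideanSpace ℝ (Fin d))‖ = 1 := fun i => e.norm_eq_one i
    simp only [hT, List.mem_append, List.mem_ofFn] at hθ
    rcases hθ with ⟨i, rfl⟩ | ⟨i, rfl⟩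
    · exact (he i).le
    · rw [norm_neg]; exact (he i).le
  have hTl : T.length = 2 * r' := by simp [hT, two_mul]
  have hB : ∀ x ∈ xs, ∀ y ∈ xs, ‖x - y‖ ≤ 2 * M := by
    intro x hx y hy
    obtain ⟨i, rfl⟩ := List.get_of_mem hx
    obtain ⟨j, rfl⟩ := List.get_of_mem hy
    have e1 : xs.get i - xs.get j = (xs.get i - mean xs) - (xs.get j - mean xs) := by abel
    rw [e1]
    exact (norm_sub_le _ _).trans (by linarith [hM i, hM j])
  have hA1 : 1 ≤ 4 * (K * (n : ℝ) ^ 2) := by nlinarith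
  have hA2 : 1 ≤ 8 * (K * (n : ℝ) ^ 2) := by linarith
  -- S bounds all σ_i², because 2/δ_j ≤ 4Kn² in every round. The level t below makes each tail equal
  -- to 1/(8Kn²), so at most 2n directions and n states cost at most 1/(4K) together; the clipping
  -- events cost another 1/(4K).
  set S : ℝ := (2 * log (4 * (K * (n : ℝ) ^ 2)) + 1) * (2 * M) ^ 2 with hS
  have hA10 := log_nonneg hA1
  have hA20 := log_nonneg hA2
  have hS0 : 0 < S := by positivity
  set t := √(2 * S * log (8 * (K * (n : ℝ) ^ 2))) with ht
  have ht2 : t ^ 2 = 2 * S * log (8 * (K * (n : ℝ) ^ 2)) := sq_sqrt (by positivity)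
  have hle : log (n / 2) + 1 ≤ n / 2 := log_div_two_add_one_le hn
  have hlog0 : 0 ≤ log ((n : ℝ) / 2) := log_nonneg (by linarith)
  have hδ : 0 < 1 / (2 * (K : ℝ)) := by positivity
  obtain ⟨l, hl, hl'⟩ := lkhRounds_bound hδ (by rw [div_le_one (by positivity)]; linarith) hn T hTn
    hS0 (sqrt_nonneg _ : 0 ≤ t) xs 1 0 heven le_rfl le_rfl (by simpa using hS0.le) hB (by
      intro j hj hj1
      rw [hS]
      have hj1' : (1 : ℝ) ≤ j := by exact_mod_cast hj1
      have hj' : (j : ℝ) ≤ n / 2 := by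
        rw [le_div_iff₀ two_pos]
        exact_mod_cast (by omega : j * 2 ≤ n)
      have e1 : 2 / roundFailure (1 / (2 * (K : ℝ))) n j = 8 * K * (j * (log (n / 2) + 1)) := by
        rw [roundFailure]; field_simp; ring
      have e2 : 2 / roundFailure (1 / (2 * (K : ℝ))) n j ≤ 4 * (K * (n : ℝ) ^ 2) := by
        rw [e1]
        have : (j : ℝ) * (log (n / 2) + 1) ≤ n / 2 * (n / 2) := by gcongr
        have := mul_le_mul_of_nonneg_left this (by positivity : (0 : ℝ) ≤ 8 * K)
        have : (0 : ℝ) ≤ K * (n : ℝ) ^ 2 := by positivity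
        nlinarith
      have : log (2 / roundFailure (1 / (2 * (K : ℝ))) n j) ≤ log (4 * (K * (n : ℝ) ^ 2)) :=
        log_le_log (by rw [e1]; positivity) e2
      gcongr)
  refine le_trans (MeasureTheory.measure_mono ?_) ((hl' 0).trans (ENNReal.ofReal_le_ofReal ?_))
  · intro sel hsel hw
    apply hsel
    refine (hw.exists_coeff hB).mono ?_
    rintro ψ ⟨hP, hnorm, s, hs, hψ⟩
    rw [zero_add] at hψ
    rw [walkRadius, min_mul_of_nonneg _ _ hM0.le]
    apply le_min
    · rw [sub_zero] at hnorm
      refine hnorm.trans (le_of_eq ?_)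
      ring
    · obtain ⟨v, hv, hv'⟩ := hV (WithLp.toLp 2 s)
      rw [toEuclideanLin_colMatrix, ← hψ] at hv'
      have hv'' : ‖ψ - v‖ ≤ √(392 * log (n * K) ^ 2) * M :=
        hv'.trans ((mul_le_mul_of_nonneg_left (norm_toLp_le_sqrt hs) (epsLevel_nonneg K xs)).trans
          (epsLevel_mul_sqrt_le hK hn hlog hM0.le hM))
      have hin : ∀ i, |inner ℝ (e i : EuclideanSpace ℝ (Fin d)) ψ| ≤ t := by
        intro i
        apply abs_le'.2
        refine ⟨hP _ (by simp [hT]), ?_⟩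
        rw [← inner_neg_left]
        exact hP _ (by simp [hT])
      have hfin := norm_le_of_inner_le V e hv hin hv''
      refine hfin.trans ?_
      have l1 : log (4 * (K * (n : ℝ) ^ 2)) ≤ 4 * log (n * K) :=
        log_const_mul_le (by positivity) hn hK hlog (by nlinarith)
      have l2 : log (8 * (K * (n : ℝ) ^ 2)) ≤ 4 * log (n * K) :=
        log_const_mul_le (by positivity) hn hK hlog le_rfl
      set ℓ := log ((n : ℝ) * K) with hℓ
      have hrr : (r' : ℝ) ≤ (max r 1 : ℕ) := by exact_mod_cast hVr.trans (le_max_left _ _)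
      have hr1 : (1 : ℝ) ≤ (max r 1 : ℕ) := by exact_mod_cast le_max_right _ _
      set R : ℝ := ((max r 1 : ℕ) : ℝ) with hR
      have hSle : S ≤ 9 * ℓ * (2 * M) ^ 2 := by
        rw [hS]
        gcongr
        linarith
      have b1 : (r' : ℝ) * t ^ 2 ≤ 288 * ℓ ^ 2 * R * M ^ 2 := by
        rw [ht2]
        calc (r' : ℝ) * (2 * S * log (8 * (K * (n : ℝ) ^ 2)))
            ≤ R * (2 * (9 * ℓ * (2 * M) ^ 2) * (4 * ℓ)) := by gcongr
          _ = 288 * ℓ ^ 2 * R * M ^ 2 := by ring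
      have b2 : √(r' * t ^ 2) ≤ √(288 * ℓ ^ 2 * R) * M := by
        refine (sqrt_le_sqrt b1).trans (le_of_eq ?_)
        rw [sqrt_mul (by positivity), sqrt_sq hM0.le]
      -- From (x + y)² ≤ 2x² + 2y² and 2(288 + 392) = 1360 ≤ 1440.
      have b3 : √(288 * ℓ ^ 2 * R) + √(392 * ℓ ^ 2) ≤ √(1440 * ℓ ^ 2 * R) := by
        apply le_sqrt_of_sq_le
        have q1 : √(288 * ℓ ^ 2 * R) ^ 2 = 288 * ℓ ^ 2 * R := sq_sqrt (by positivity)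
        have q2 : √(392 * ℓ ^ 2) ^ 2 = 392 * ℓ ^ 2 := sq_sqrt (by positivity)
        have q3 : ℓ ^ 2 * 1 ≤ ℓ ^ 2 * R := by gcongr
        nlinarith [sq_nonneg (√(288 * ℓ ^ 2 * R) - √(392 * ℓ ^ 2)), sq_nonneg ℓ]
      have := mul_le_mul_of_nonneg_right b3 hM0.le
      linarith
  · have e0 : expSum l 0 = expWeight l 0 := by
      simp [expSum, expWeight]
    rw [e0]
    refine hl.trans ?_
    have s1 := sum_roundFailure_le hδ hn
    have e1 : exp (-(t ^ 2 / (2 * S))) = 1 / (8 * (K * (n : ℝ) ^ 2)) := by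
      rw [ht2, mul_div_cancel_left₀ _ (by positivity), exp_neg, exp_log (by positivity), one_div]
    rw [e1, hTl]
    have s2 : (((n / 2 : ℕ) : ℝ) + 1) * (((2 * r' : ℕ) : ℝ) * (1 / (8 * (K * (n : ℝ) ^ 2)))) ≤
        n * ((2 * n) * (1 / (8 * (K * (n : ℝ) ^ 2)))) := by
      have a1 : (((n / 2 : ℕ) : ℝ) + 1) ≤ n := by exact_mod_cast (by omega : n / 2 + 1 ≤ n)
      have a2 : ((2 * r' : ℕ) : ℝ) ≤ 2 * n := by exact_mod_cast (by omega : 2 * r' ≤ 2 * n)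
      gcongr
    have e2 : (n : ℝ) * ((2 * n) * (1 / (8 * (K * (n : ℝ) ^ 2)))) = 1 / (2 * (K : ℝ)) / 2 := by
      field_simp
      norm_num
    linarith

end LKHSGD

/-! ### Thinned reordering and prefix discrepancy. -/

namespace LKHSGD

section Lists

variable {ι κ : Type*}

theorem map_reorder (g : ι → κ) (π : List ι) (sel : List Bool) :
    (reorder π sel).map g = reorder (π.map g) sel := by
  simp only [reorder, List.map_append, List.map_reverse, List.map_map, List.zip_map_left,
    List.filter_map]
  rfl

theorem reorder_perm {π : List ι} {sel : List Bool} (h : π.length = sel.length) :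
    (reorder π sel).Perm π := by
  rw [reorder]
  refine ((List.reverse_perm _).append_left _).trans ?_
  rw [← List.map_append]
  refine ((List.filter_append_perm (fun q : ι × Bool => q.2) (π.zip sel)).map Prod.fst).trans ?_
  rw [List.map_fst_zip h.le]

/-- The supremum of `φ` over the prefixes of a list. -/
noncomputable def prefixSup (π : List ι) (φ : List ι → ℝ) : ℝ :=
  ⨆ j : Fin (π.length + 1), φ (π.take j)

theorem le_prefixSup {π l : List ι} (φ : List ι → ℝ) (h : l <+: π) : φ l ≤ prefixSup π φ := by
  have e := List.prefix_iff_eq_take.1 h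
  have := le_ciSup (f := fun j : Fin (π.length + 1) => φ (π.take j))
    (Set.finite_range _).bddAbove ⟨l.length, Nat.lt_succ_of_le h.length_le⟩
  simp only [← e] at this
  exact this

theorem prefixSup_le {π : List ι} {φ : List ι → ℝ} {B : ℝ} (h : ∀ l, l <+: π → φ l ≤ B) :
    prefixSup π φ ≤ B :=
  ciSup_le fun _ => h _ (List.take_prefix _ _)

end Lists

section Herding

variable {E : Type*} [NormedAddCommGroup E] [NormedSpace ℝ E]

theorem HalvingWalk.length_eq {P : E → Prop} {ψ : E} {xs : List E} {sel : List Bool}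
    (h : HalvingWalk P ψ xs sel) : xs.length = sel.length := by
  induction h with
  | nil _ => rfl
  | cons s _ _ ih => simp [ih]

theorem HalvingWalk.map_sub {P : E → Prop} {ψ : E} {xs : List E} {sel : List Bool} (c : E)
    (h : HalvingWalk P ψ xs sel) : HalvingWalk P ψ (xs.map (· - c)) sel := by
  induction h with
  | nil h => exact .nil h
  | cons s h _ ih => exact .cons s h (by simpa using ih)

/-- For each pair, twice the selected point is the sum of the pair minus the signed difference added
to ψ. Summing over the first pairs gives the identity; the unselected points obey it with the
opposite sign. -/
theorem HalvingWalk.exists_of_prefix_selected {P : E → Prop} {ψ : E} {xs : List E}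
    {sel : List Bool} (h : HalvingWalk P ψ xs sel) :
    ∀ l, l <+: ((xs.zip sel).filter fun q => q.2).map Prod.fst →
      ∃ p, p <+: xs ∧ ∃ ψ', P ψ' ∧ (2 : ℝ) • l.sum = p.sum - (ψ' - ψ) := by
  induction h with
  | @nil ψ h =>
    intro l hl
    exact ⟨[], List.nil_prefix, ψ, h, by simp_all⟩
  | @cons ψ x x' xs sel s h _ ih =>
    intro l hl
    have e : ((((x :: x' :: xs).zip ((!s) :: s :: sel))).filter fun q => q.2).map Prod.fst =
        (if s then x' else x) :: ((xs.zip sel).filter fun q => q.2).map Prod.fst := by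
      cases s <;> simp
    rw [e] at hl
    rcases l with - | ⟨y, l⟩
    · exact ⟨[], List.nil_prefix, ψ, h, by simp⟩
    · obtain ⟨rfl, hl'⟩ := List.cons_prefix_cons.1 hl
      obtain ⟨p, hp, ψ', hψ', heq⟩ := ih l hl'
      refine ⟨x :: x' :: p, by simpa [List.cons_prefix_cons] using hp, ψ', hψ', ?_⟩
      rw [List.sum_cons, smul_add, heq]
      cases s
      · simp [two_smul]; abel
      · simp [two_smul]; abel

theorem HalvingWalk.exists_of_prefix_unselected {P : E → Prop} {ψ : E} {xs : List E}
    {sel : List Bool} (h : HalvingWalk P ψ xs sel) :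
    ∀ l, l <+: ((xs.zip sel).filter fun q => !q.2).map Prod.fst →
      ∃ p, p <+: xs ∧ ∃ ψ', P ψ' ∧ (2 : ℝ) • l.sum = p.sum + (ψ' - ψ) := by
  induction h with
  | @nil ψ h =>
    intro l hl
    exact ⟨[], List.nil_prefix, ψ, h, by simp_all⟩
  | @cons ψ x x' xs sel s h _ ih =>
    intro l hl
    have e : ((((x :: x' :: xs).zip ((!s) :: s :: sel))).filter fun q => !q.2).map Prod.fst =
        (if s then x else x') :: ((xs.zip sel).filter fun q => !q.2).map Prod.fst := by
      cases s <;> simp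
    rw [e] at hl
    rcases l with - | ⟨y, l⟩
    · exact ⟨[], List.nil_prefix, ψ, h, by simp⟩
    · obtain ⟨rfl, hl'⟩ := List.cons_prefix_cons.1 hl
      obtain ⟨p, hp, ψ', hψ', heq⟩ := ih l hl'
      refine ⟨x :: x' :: p, by simpa [List.cons_prefix_cons] using hp, ψ', hψ', ?_⟩
      rw [List.sum_cons, smul_add, heq]
      cases s
      · simp [two_smul]; abel
      · simp [two_smul]; abel

/-- Thinned reordering halves the prefix discrepancy up to the size of the signed sums. -/
theorem norm_sum_prefix_reorder_le {xs : List E} {sel : List Bool} {S H : ℝ}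
    (h : HalvingWalk (fun ψ => ‖ψ‖ ≤ S) 0 xs sel) (hsum : xs.sum = 0)
    (hH : ∀ p, p <+: xs → ‖p.sum‖ ≤ H) {l : List E} (hl : l <+: reorder xs sel) :
    ‖l.sum‖ ≤ (H + S) / 2 := by
  have half : ∀ {a p ψ : E}, ‖p‖ ≤ H → ‖ψ‖ ≤ S → (2 : ℝ) • a = p + ψ → ‖a‖ ≤ (H + S) / 2 := by
    intro a p ψ hp hψ e
    have h2 : ‖(2 : ℝ) • a‖ ≤ H + S := by
      rw [e]; exact (norm_add_le _ _).trans (add_le_add hp hψ)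
    rw [norm_smul, Real.norm_eq_abs, abs_two] at h2
    linarith
  have hsel : ∀ l, l <+: ((xs.zip sel).filter fun q => q.2).map Prod.fst →
      ‖l.sum‖ ≤ (H + S) / 2 := by
    intro l hl
    obtain ⟨p, hp, ψ', hψ', e⟩ := h.exists_of_prefix_selected l hl
    exact half (ψ := -ψ') (hH p hp) (by simpa using hψ') (by rw [e, sub_zero, sub_eq_add_neg])
  have hunsel : ∀ l, l <+: ((xs.zip sel).filter fun q => !q.2).map Prod.fst →
      ‖l.sum‖ ≤ (H + S) / 2 := by
    intro l hl
    obtain ⟨p, hp, ψ', hψ', e⟩ := h.exists_of_prefix_unselected l hl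
    exact half (hH p hp) hψ' (by rw [e, sub_zero])
  obtain ⟨m, hm⟩ := hl
  have htot : l.sum + m.sum = 0 := by
    rw [← List.sum_append, hm, (reorder_perm h.length_eq).sum_eq, hsum]
  rw [reorder] at hm
  -- Either the prefix ends among the selected points, or its complement does end-first among the
  -- unselected ones: reversed, that complement is a prefix of the unselected list. Since the total
  -- is zero, the prefix and its complement have sums of equal norm.
  rcases List.append_eq_append_iff.1 hm with ⟨a, ha, -⟩ | ⟨a, -, ha⟩
  · exact hsel l ⟨a, ha.symm⟩
  · rw [eq_neg_of_add_eq_zero_left htot, norm_neg, ← List.sum_reverse]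
    apply hunsel
    refine ⟨a.reverse, ?_⟩
    rw [← List.reverse_append, ← ha, List.reverse_reverse]

end Herding

end LKHSGD

/-! ### Smoothness, and the estimates for one epoch of SGD. -/

namespace LKHSGD

variable {d n : ℕ}

section Smooth

variable {E : Type*} [NormedAddCommGroup E] [InnerProductSpace ℝ E] [CompleteSpace E]

/-- The descent lemma for functions with Lipschitz gradient. -/
theorem le_add_inner_add_sq {φ : E → ℝ} (hφ : Differentiable ℝ φ) {L : ℝ}
    (hL : ∀ w v, ‖∇ φ w - ∇ φ v‖ ≤ L * ‖w - v‖) (x v : E) :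
    φ (x + v) ≤ φ x + inner ℝ (∇ φ x) v + L / 2 * ‖v‖ ^ 2 := by
  set h : ℝ → ℝ := fun t => φ (x + t • v) - t * inner ℝ (∇ φ x) v - L / 2 * ‖v‖ ^ 2 * t ^ 2
    with hh
  have hder : ∀ t, HasDerivAt h
      (inner ℝ (∇ φ (x + t • v)) v - inner ℝ (∇ φ x) v - L / 2 * ‖v‖ ^ 2 * (2 * t)) t := by
    intro t
    have h1 : HasDerivAt (fun t : ℝ => x + t • v) v t := by
      simpa using ((hasDerivAt_id t).smul_const v).const_add x
    have h2 := (hφ (x + t • v)).hasGradientAt.hasFDerivAt.comp_hasDerivAt t h1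
    have h3 : HasDerivAt (fun t : ℝ => t * inner ℝ (∇ φ x) v) (inner ℝ (∇ φ x) v) t := by
      simpa using (hasDerivAt_id t).mul_const (inner ℝ (∇ φ x) v)
    have h4 : HasDerivAt (fun t : ℝ => L / 2 * ‖v‖ ^ 2 * t ^ 2) (L / 2 * ‖v‖ ^ 2 * (2 * t)) t := by
      simpa using (hasDerivAt_pow 2 t).const_mul (L / 2 * ‖v‖ ^ 2)
    exact (h2.sub h3).sub h4
  have hanti : AntitoneOn h (Set.Icc 0 1) := by
    refine antitoneOn_of_deriv_nonpos (convex_Icc 0 1)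
      (fun t _ => (hder t).continuousAt.continuousWithinAt)
      (fun t _ => (hder t).differentiableAt.differentiableWithinAt) fun t ht => ?_
    rw [interior_Icc] at ht
    rw [(hder t).deriv, ← inner_sub_left]
    have h1 := (real_inner_le_norm (∇ φ (x + t • v) - ∇ φ x) v).trans
      (mul_le_mul_of_nonneg_right (hL (x + t • v) x) (norm_nonneg v))
    rw [add_sub_cancel_left, norm_smul, Real.norm_eq_abs, abs_of_pos ht.1] at h1
    linarith
  have := hanti (Set.left_mem_Icc.2 zero_le_one) (Set.right_mem_Icc.2 zero_le_one) zero_le_one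
  simp only [hh, one_smul, zero_smul, add_zero] at this
  linarith

/-- A gradient step of length 1/L decreases φ by at least ‖∇φ‖²/(2L), yet cannot go below m. -/
theorem norm_gradient_sq_le {φ : E → ℝ} (hφ : Differentiable ℝ φ) {L : ℝ} (hL0 : 0 < L)
    (hL : ∀ w v, ‖∇ φ w - ∇ φ v‖ ≤ L * ‖w - v‖) {m : ℝ} (hm : ∀ v, m ≤ φ v) (x : E) :
    ‖∇ φ x‖ ^ 2 ≤ 2 * L * (φ x - m) := by
  have h := (hm _).trans (le_add_inner_add_sq hφ hL x (-(1 / L) • ∇ φ x))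
  rw [inner_smul_right, real_inner_self_eq_norm_sq, norm_smul, mul_pow, Real.norm_eq_abs, sq_abs]
    at h
  have e : φ x + -(1 / L) * ‖∇ φ x‖ ^ 2 + L / 2 * ((-(1 / L)) ^ 2 * ‖∇ φ x‖ ^ 2) =
      φ x - ‖∇ φ x‖ ^ 2 / (2 * L) := by
    field_simp
    ring
  rw [e] at h
  have h2 : ‖∇ φ x‖ ^ 2 / (2 * L) ≤ φ x - m := by linarith
  rw [div_le_iff₀ (by positivity)] at h2
  linarith

/-- One gradient step with an inexact gradient. -/
theorem inexact_step_le {φ : E → ℝ} (hφ : Differentiable ℝ φ) {L η : ℝ} (hη : 0 ≤ η)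
    (hηL : η * L ≤ 1) (hL : ∀ w v, ‖∇ φ w - ∇ φ v‖ ≤ L * ‖w - v‖) (x g : E) :
    φ (x - η • g) ≤ φ x - η / 2 * ‖∇ φ x‖ ^ 2 + η / 2 * ‖g - ∇ φ x‖ ^ 2 := by
  have h := le_add_inner_add_sq hφ hL x (-(η • g))
  rw [← sub_eq_add_neg, norm_neg, norm_smul, mul_pow, Real.norm_eq_abs, sq_abs, inner_neg_right,
    inner_smul_right] at h
  rw [norm_sub_sq_real, real_inner_comm]
  have : L / 2 * (η ^ 2 * ‖g‖ ^ 2) ≤ η / 2 * ‖g‖ ^ 2 := by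
    have := mul_le_mul_of_nonneg_right hηL (by positivity : 0 ≤ η / 2 * ‖g‖ ^ 2)
    linarith
  linarith

end Smooth

section Risk

variable {f : Fin n → EuclideanSpace ℝ (Fin d) → ℝ}

theorem hasGradientAt_risk (hf : ∀ i, Differentiable ℝ (f i)) (w : EuclideanSpace ℝ (Fin d)) :
    HasGradientAt (risk f) ((1 / (n : ℝ)) • ∑ i, ∇ (f i) w) w := by
  rw [hasGradientAt_iff_hasFDerivAt]
  have h := (HasFDerivAt.fun_sum (u := Finset.univ)
    (fun i _ => ((hf i) w).hasGradientAt.hasFDerivAt)).const_mul (1 / (n : ℝ))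
  refine h.congr_fderiv ?_
  rw [map_smulₛₗ, map_sum]
  simp

theorem gradient_risk (hf : ∀ i, Differentiable ℝ (f i)) (w : EuclideanSpace ℝ (Fin d)) :
    ∇ (risk f) w = (1 / (n : ℝ)) • ∑ i, ∇ (f i) w :=
  (hasGradientAt_risk hf w).gradient

theorem differentiable_risk (hf : ∀ i, Differentiable ℝ (f i)) : Differentiable ℝ (risk f) :=
  fun w => (hasGradientAt_risk hf w).differentiableAt

theorem norm_average_sub_le {E : Type*} [NormedAddCommGroup E] [NormedSpace ℝ E] (hn : 0 < n)
    {a b : Fin n → E} {c : ℝ} (h : ∀ i, ‖a i - b i‖ ≤ c) :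
    ‖(1 / (n : ℝ)) • ∑ i, a i - (1 / (n : ℝ)) • ∑ i, b i‖ ≤ c := by
  have hn' : (0 : ℝ) < n := by exact_mod_cast hn
  rw [← smul_sub, ← Finset.sum_sub_distrib, norm_smul, Real.norm_of_nonneg (by positivity),
    one_div, inv_mul_le_iff₀ hn']
  exact (norm_sum_le_of_le _ fun i _ => h i).trans (by simp)

theorem lipschitz_gradient_risk (hn : 0 < n) (hf : ∀ i, Differentiable ℝ (f i)) {L : ℝ}
    (hL : ∀ i w v, ‖∇ (f i) w - ∇ (f i) v‖ ≤ L * ‖w - v‖) (w v : EuclideanSpace ℝ (Fin d)) :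
    ‖∇ (risk f) w - ∇ (risk f) v‖ ≤ L * ‖w - v‖ := by
  rw [gradient_risk hf, gradient_risk hf]
  exact norm_average_sub_le hn fun i => hL i w v

end Risk

section Epoch

variable (f : Fin n → EuclideanSpace ℝ (Fin d) → ℝ) (α : ℝ)

theorem sgdEpoch_cons (w : EuclideanSpace ℝ (Fin d)) (i : Fin n) (π : List (Fin n)) :
    sgdEpoch f α w (i :: π) = sgdEpoch f α (sgdStep f α w i) π := rfl

theorem stochGrads_length (w : EuclideanSpace ℝ (Fin d)) (π : List (Fin n)) :
    (stochGrads f α w π).length = π.length := by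
  induction π generalizing w with
  | nil => rfl
  | cons i π ih => simp [stochGrads, ih]

theorem sgdEpoch_eq (w : EuclideanSpace ℝ (Fin d)) (π : List (Fin n)) :
    sgdEpoch f α w π = w - α • (stochGrads f α w π).sum := by
  induction π generalizing w with
  | nil => simp [sgdEpoch, stochGrads]
  | cons i π ih =>
    rw [sgdEpoch_cons, ih, stochGrads, List.sum_cons, smul_add, sgdStep]
    abel

theorem stochGrads_prefix (w : EuclideanSpace ℝ (Fin d)) {l π : List (Fin n)} (h : l <+: π) :
    stochGrads f α w l <+: stochGrads f α w π := by
  induction l generalizing w π with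
  | nil => exact List.nil_prefix
  | cons i l ih =>
    rcases π with - | ⟨j, π⟩
    · simp at h
    · obtain ⟨rfl, h'⟩ := List.cons_prefix_cons.1 h
      exact List.cons_prefix_cons.2 ⟨rfl, ih _ h'⟩

/-- In an epoch without repetitions the stochastic gradients are indexed by the losses. -/
theorem exists_stochGrads_eq_map (w : EuclideanSpace ℝ (Fin d)) {π : List (Fin n)}
    (hπ : π.Nodup) : ∃ g : Fin n → EuclideanSpace ℝ (Fin d), stochGrads f α w π = π.map g ∧
      ∀ i ∈ π, ∃ l, l <+: π ∧ g i = ∇ (f i) (sgdEpoch f α w l) := by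
  induction π generalizing w with
  | nil => exact ⟨fun _ => 0, rfl, by simp⟩
  | cons i π ih =>
    obtain ⟨hi, hπ⟩ := List.nodup_cons.1 hπ
    obtain ⟨g, hg, hg'⟩ := ih (sgdStep f α w i) hπ
    refine ⟨Function.update g i (∇ (f i) w), ?_, fun j hj => ?_⟩
    · rw [stochGrads, hg, List.map_cons, Function.update_self]
      congr 1
      refine List.map_congr_left fun j hj => ?_
      rw [Function.update_of_ne]
      rintro rfl
      exact hi hj
    · by_cases hji : j = i
      · subst hji
        exact ⟨[], List.nil_prefix, by simp [sgdEpoch]⟩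
      · obtain ⟨l, hl, e⟩ := hg' j ((List.mem_cons.1 hj).resolve_left hji)
        exact ⟨i :: l, List.cons_prefix_cons.2 ⟨rfl, hl⟩, by
          rw [Function.update_of_ne hji, e, sgdEpoch_cons]⟩

/-- The largest distance of the iterates of an epoch from its starting point. -/
noncomputable def drift (s : EuclideanSpace ℝ (Fin d) × List (Fin n)) : ℝ :=
  prefixSup s.2 fun l => ‖sgdEpoch f α s.1 l - s.1‖

/-- The prefix discrepancy of a list of points. -/
noncomputable def discrepancy (xs : List (EuclideanSpace ℝ (Fin d))) : ℝ :=
  prefixSup xs fun l => ‖(l.map (· - mean xs)).sum‖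

theorem discrepancy_nonneg (xs : List (EuclideanSpace ℝ (Fin d))) : 0 ≤ discrepancy xs :=
  (norm_nonneg _).trans (le_prefixSup (fun l => ‖(l.map (· - mean xs)).sum‖)
    (List.nil_prefix : [] <+: xs))

theorem drift_nonneg (s : EuclideanSpace ℝ (Fin d) × List (Fin n)) : 0 ≤ drift f α s :=
  (norm_nonneg _).trans (le_prefixSup (fun l => ‖sgdEpoch f α s.1 l - s.1‖)
    (List.nil_prefix : [] <+: s.2))

theorem sum_map_sub {E : Type*} [NormedAddCommGroup E] [NormedSpace ℝ E] (l : List E) (c : E) :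
    (l.map (· - c)).sum = l.sum - (l.length : ℝ) • c := by
  induction l with
  | nil => simp
  | cons x l ih =>
    rw [List.map_cons, List.sum_cons, ih, List.sum_cons, List.length_cons]
    push_cast
    rw [add_smul, one_smul]
    abel

theorem norm_sum_map_le {ι E : Type*} [NormedAddCommGroup E] (l : List ι) {g : ι → E} {c : ℝ}
    (h : ∀ i, ‖g i‖ ≤ c) : ‖(l.map g).sum‖ ≤ l.length * c := by
  induction l with
  | nil => simp
  | cons x l ih =>
    rw [List.map_cons, List.sum_cons, List.length_cons]
    push_cast
    refine (norm_add_le _ _).trans ?_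
    linarith [h x]

variable {f α}

theorem mean_map_of_perm {π : List (Fin n)} (hπ : π.Perm (List.finRange n))
    (g : Fin n → EuclideanSpace ℝ (Fin d)) :
    mean (π.map g) = (1 / (n : ℝ)) • ∑ i, g i := by
  rw [mean, List.length_map, hπ.length_eq, List.length_finRange, (hπ.map g).sum_eq]
  rw [Fin.sum_univ_def]

/-- The quantitative facts about one epoch. -/
theorem epoch_bounds (hn : 0 < n) (hf : ∀ i, Differentiable ℝ (f i)) {L σ : ℝ} (hL0 : 0 ≤ L)
    (hα : 0 ≤ α) (hσ : ∀ i w, ‖∇ (f i) w - ∇ (risk f) w‖ ≤ σ)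
    (hL : ∀ i w v, ‖∇ (f i) w - ∇ (f i) v‖ ≤ L * ‖w - v‖)
    (s : EuclideanSpace ℝ (Fin d) × List (Fin n)) (hs : s.2.Perm (List.finRange n)) :
    ∃ g : Fin n → EuclideanSpace ℝ (Fin d), stochGrads f α s.1 s.2 = s.2.map g ∧
      (∀ i, ‖g i - ∇ (f i) s.1‖ ≤ L * drift f α s) ∧
      ‖mean (stochGrads f α s.1 s.2) - ∇ (risk f) s.1‖ ≤ L * drift f α s ∧
      drift f α s ≤ α * discrepancy (stochGrads f α s.1 s.2) +
        α * n * (‖∇ (risk f) s.1‖ + L * drift f α s) ∧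
      (∀ i, ‖g i - mean (stochGrads f α s.1 s.2)‖ ≤ σ + 2 * (L * drift f α s)) ∧
      sgdEpoch f α s.1 s.2 = s.1 - (α * n) • mean (stochGrads f α s.1 s.2) ∧
      ‖sgdEpoch f α s.1 s.2 - s.1‖ ≤ drift f α s := by
  obtain ⟨g, hg, hg'⟩ := exists_stochGrads_eq_map f α s.1
    (hs.nodup_iff.2 (List.nodup_finRange n))
  have hlen : (stochGrads f α s.1 s.2).length = n := by
    rw [stochGrads_length, hs.length_eq, List.length_finRange]
  have h1 : ∀ i, ‖g i - ∇ (f i) s.1‖ ≤ L * drift f α s := by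
    intro i
    obtain ⟨l, hl, e⟩ := hg' i (hs.mem_iff.2 (List.mem_finRange i))
    rw [e]
    exact (hL _ _ _).trans (mul_le_mul_of_nonneg_left
      (le_prefixSup (fun l => ‖sgdEpoch f α s.1 l - s.1‖) hl) hL0)
  have hmean : mean (stochGrads f α s.1 s.2) = (1 / (n : ℝ)) • ∑ i, g i := by
    rw [hg, mean_map_of_perm hs]
  have h2 : ‖mean (stochGrads f α s.1 s.2) - ∇ (risk f) s.1‖ ≤ L * drift f α s := by
    rw [hmean, gradient_risk hf]
    exact norm_average_sub_le hn h1
  refine ⟨g, hg, h1, h2, ?_, fun i => ?_, ?_, ?_⟩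
  · refine prefixSup_le fun l hl => ?_
    set x := mean (stochGrads f α s.1 s.2) with hx
    have hd := le_prefixSup (fun l => ‖(l.map (· - x)).sum‖) (stochGrads_prefix f α s.1 hl)
    have hsum := sum_map_sub (stochGrads f α s.1 l) x
    -- The displacement splits into a centred partial sum, bounded by the discrepancy, and a
    -- multiple of the mean gradient. The resulting bound contains the drift on both sides; it is
    -- solved for later, using αnL ≤ 1/32.
    have e : sgdEpoch f α s.1 l - s.1 = -(α • ((stochGrads f α s.1 l).map (· - x)).sum +
        (α * (l.length : ℝ)) • x) := by
      rw [sgdEpoch_eq, hsum, stochGrads_length, smul_sub, smul_smul]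
      abel
    have hll : (l.length : ℝ) ≤ n := by
      have := hl.length_le
      rw [hs.length_eq, List.length_finRange] at this
      exact_mod_cast this
    have hxn : ‖x‖ ≤ ‖∇ (risk f) s.1‖ + L * drift f α s := by
      have : x = ∇ (risk f) s.1 + (x - ∇ (risk f) s.1) := by abel
      rw [this]
      exact (norm_add_le _ _).trans (by linarith)
    rw [e, norm_neg]
    refine (norm_add_le _ _).trans ?_
    rw [norm_smul, norm_smul, Real.norm_of_nonneg hα, Real.norm_of_nonneg (by positivity)]
    have hd' : ‖((stochGrads f α s.1 l).map (· - x)).sum‖ ≤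
      discrepancy (stochGrads f α s.1 s.2) := hd
    gcongr
  · have e : g i - mean (stochGrads f α s.1 s.2) = (g i - ∇ (f i) s.1) +
        (∇ (f i) s.1 - ∇ (risk f) s.1) - (mean (stochGrads f α s.1 s.2) - ∇ (risk f) s.1) := by
      abel
    rw [e]
    refine (norm_sub_le _ _).trans ((add_le_add_left (norm_add_le _ _) _).trans ?_)
    linarith [h1 i, hσ i s.1]
  · rw [sgdEpoch_eq, mean, hlen, smul_smul]
    congr 2
    field_simp
  · exact le_prefixSup (fun l => ‖sgdEpoch f α s.1 l - s.1‖) (List.prefix_refl s.2)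

theorem risk_sgdEpoch_le (hn : 0 < n) (hf : ∀ i, Differentiable ℝ (f i)) {L : ℝ}
    (hα : 0 ≤ α) (hαL : α * n * L ≤ 1)
    (hL : ∀ i w v, ‖∇ (f i) w - ∇ (f i) v‖ ≤ L * ‖w - v‖)
    {w x : EuclideanSpace ℝ (Fin d)} {D : ℝ} (hx : ‖x - ∇ (risk f) w‖ ≤ L * D) :
    risk f (w - (α * n) • x) ≤ risk f w - α * n / 2 * ‖∇ (risk f) w‖ ^ 2 +
      α * n / 2 * (L * D) ^ 2 := by
  have h := inexact_step_le (differentiable_risk hf) (η := α * n) (by positivity) hαL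
    (lipschitz_gradient_risk hn hf hL) w x
  refine h.trans ?_
  gcongr

/-- The discrepancy after reordering. -/
theorem discrepancy_next_le (hn : 0 < n) (hf : ∀ i, Differentiable ℝ (f i)) {L σ : ℝ}
    (hL0 : 0 ≤ L) (hα : 0 ≤ α) (hσ : ∀ i w, ‖∇ (f i) w - ∇ (risk f) w‖ ≤ σ)
    (hL : ∀ i w v, ‖∇ (f i) w - ∇ (f i) v‖ ≤ L * ‖w - v‖)
    {s s' : EuclideanSpace ℝ (Fin d) × List (Fin n)} (hs : s.2.Perm (List.finRange n))
    {sel : List Bool} {S : ℝ} (hw' : s'.1 = sgdEpoch f α s.1 s.2) (hπ' : s'.2 = reorder s.2 sel)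
    (hwalk : HalvingWalk (fun ψ => ‖ψ‖ ≤ S) 0 (stochGrads f α s.1 s.2) sel) :
    discrepancy (stochGrads f α s'.1 s'.2) ≤ (discrepancy (stochGrads f α s.1 s.2) + S) / 2 +
      2 * (n * (L * (drift f α s' + 2 * drift f α s))) := by
  have hlen : s.2.length = sel.length := by
    rw [← hwalk.length_eq, stochGrads_length]
  have hs' : s'.2.Perm (List.finRange n) := by
    rw [hπ']
    exact (reorder_perm hlen).trans hs
  obtain ⟨g, hg, hg1, -, -, -, -, hgd⟩ := epoch_bounds hn hf hL0 hα hσ hL s hs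
  obtain ⟨g', hg', hg1', -⟩ := epoch_bounds hn hf hL0 hα hσ hL s' hs'
  set x := mean (stochGrads f α s.1 s.2) with hx
  set x' := mean (stochGrads f α s'.1 s'.2) with hx'
  set c := L * (drift f α s' + 2 * drift f α s) with hc
  -- The same loss is compared in two consecutive epochs: the drift inside the new one, the distance
  -- between the two starting points, and the drift inside the old one contribute L·drift each.
  have hdiff : ∀ i, ‖g' i - g i‖ ≤ c := by
    intro i
    have e : g' i - g i = (g' i - ∇ (f i) s'.1) + (∇ (f i) s'.1 - ∇ (f i) s.1) -
        (g i - ∇ (f i) s.1) := by abel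
    rw [e]
    refine (norm_sub_le _ _).trans ((add_le_add_left (norm_add_le _ _) _).trans ?_)
    have h1 := (hL i s'.1 s.1).trans (mul_le_mul_of_nonneg_left (hw' ▸ hgd) hL0)
    linarith [hg1 i, hg1' i]
  have hmean : ‖x' - x‖ ≤ c := by
    rw [hx', hx, hg, hg', mean_map_of_perm hs, mean_map_of_perm hs']
    exact norm_average_sub_le hn hdiff
  have hc0 : 0 ≤ c := (norm_nonneg _).trans hmean
  refine prefixSup_le fun l hl => ?_
  rw [hg'] at hl
  obtain ⟨p, hp, rfl⟩ := List.prefix_map_iff.1 hl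
  have hpn : (p.length : ℝ) ≤ n := by
    have := hp.length_le
    rw [hs'.length_eq, List.length_finRange] at this
    exact_mod_cast this
  -- The old gradients in the new order are handled by the halving; the change of the gradients and
  -- of their mean is a perturbation of at most 2c per term.
  have hsplit : ((p.map g').map (· - x')).sum = ((p.map g).map (· - x)).sum +
      (p.map fun i => (g' i - g i) - (x' - x)).sum := by
    rw [List.map_map, List.map_map, ← List.sum_map_add]
    congr 1
    refine List.map_congr_left fun i _ => ?_
    simp only [Function.comp_apply]
    abel
  have hfirst : ‖((p.map g).map (· - x)).sum‖ ≤
      (discrepancy (stochGrads f α s.1 s.2) + S) / 2 := by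
    refine norm_sum_prefix_reorder_le (hwalk.map_sub x) ?_ (fun q hq => ?_) ?_
    · rw [sum_map_sub, hx, mean, smul_smul, stochGrads_length, hs.length_eq,
        List.length_finRange, mul_one_div_cancel (by exact_mod_cast hn.ne'), one_smul, sub_self]
    · obtain ⟨l, hl, rfl⟩ := List.prefix_map_iff.1 hq
      exact le_prefixSup (fun l => ‖(l.map (· - x)).sum‖) hl
    · rw [hg, ← map_reorder, ← map_reorder, ← hπ']
      exact (hp.map g).map _
  have hsecond : ‖(p.map fun i => (g' i - g i) - (x' - x)).sum‖ ≤ p.length * (2 * c) := by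
    refine norm_sum_map_le p fun i => (norm_sub_le _ _).trans ?_
    linarith [hdiff i]
  have hthird : p.length * (2 * c) ≤ n * (2 * c) := by gcongr
  change ‖((p.map g').map (· - x')).sum‖ ≤ _
  rw [hsplit]
  refine (norm_add_le _ _).trans ?_
  linarith

end Epoch

end LKHSGD

/-! ### The Lyapunov recursion along balanced epochs. -/

namespace LKHSGD

section Recursion

/-- The scalar recursion for the potential `F + 8 η h²`, where `h` is the rescaled discrepancy, `D`
the rescaled drift, `G` the gradient norm and `q` the rescaled noise level. -/
theorem potential_step {F F' G G' D D' h h' q η κ μ s : ℝ} (hη : 0 ≤ η)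
    (hκ : κ ≤ 1 / 32) (hG : 0 ≤ G) (hD : 0 ≤ D) (hD' : 0 ≤ D') (hG'0 : 0 ≤ G') (hh : 0 ≤ h)
    (hh' : 0 ≤ h') (hq : 0 ≤ q) (hητ : η * μ / 2 ≤ 1 / 64)
    (e3 : D ≤ h + κ * (G + D)) (e3' : D' ≤ h' + κ * (G' + D')) (e7 : G' ≤ G + D)
    (e4 : s ≤ 2 * q + 2 * (κ * D)) (e8 : h' ≤ (h + s) / 2 + 2 * (κ * (D' + 2 * D)))
    (e6 : F' ≤ F - η / 2 * G ^ 2 + η / 2 * D ^ 2) (hPL : F ≤ 1 / (2 * μ) * G ^ 2) (hμ : 0 < μ) :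
    F' + 8 * η * h' ^ 2 ≤ (1 - η * μ / 2) * (F + 8 * η * h ^ 2) + 56 * η * q ^ 2 := by
  have k1 : κ * (G + D) ≤ 1 / 32 * (G + D) := by gcongr
  have k2 : κ * (G' + D') ≤ 1 / 32 * (G' + D') := by gcongr
  have k3 : κ * D ≤ 1 / 32 * D := by gcongr
  have k4 : κ * (D' + 2 * D) ≤ 1 / 32 * (D' + 2 * D) := by gcongr
  -- Solving the self-referential drift bounds with κ ≤ 1/32. The factor 1/2 from the reordering
  -- thereby becomes 0.71 in the next line, still below 1 after Young's inequality (0.757 for the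
  -- squares).
  have d1 : D ≤ 33 / 31.9 * h + 1 / 30 * G := by linarith
  have l1 : h' ≤ 0.71 * h + 1.08 * q + 0.008 * G := by linarith
  have s1 : h' ^ 2 ≤ (0.71 * h + 1.08 * q + 0.008 * G) ^ 2 := pow_le_pow_left₀ hh' l1 2
  have s2 : (0.71 * h + 1.08 * q + 0.008 * G) ^ 2 ≤ 0.757 * h ^ 2 + 7 * q ^ 2 + 0.0004 * G ^ 2 := by
    nlinarith [sq_nonneg (0.5 * (0.71 * h) - (1.08 * q + 0.008 * G)),
      sq_nonneg (1.08 * q - 0.008 * G)]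
  have s3 : D ^ 2 ≤ (33 / 31.9 * h + 1 / 30 * G) ^ 2 := pow_le_pow_left₀ hD d1 2
  have s4 : (33 / 31.9 * h + 1 / 30 * G) ^ 2 ≤ 2.2 * h ^ 2 + 0.003 * G ^ 2 := by
    nlinarith [sq_nonneg (33 / 31.9 * h - 1 / 30 * G)]
  have hPL' : μ * F ≤ G ^ 2 / 2 := by
    have := mul_le_mul_of_nonneg_left hPL hμ.le
    have e : μ * (1 / (2 * μ) * G ^ 2) = G ^ 2 / 2 := by field_simp
    linarith
  have t1 := mul_le_mul_of_nonneg_left (s1.trans s2) (by positivity : 0 ≤ 8 * η)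
  have t2 := mul_le_mul_of_nonneg_left (s3.trans s4) (by positivity : 0 ≤ η / 2)
  have t3 := mul_le_mul_of_nonneg_left hPL' (by positivity : 0 ≤ η / 2)
  have t4 := mul_le_mul_of_nonneg_right hητ (by positivity : 0 ≤ 8 * η * h ^ 2)
  have t5 : 0 ≤ η * G ^ 2 := by positivity
  have t6 : 0 ≤ η * h ^ 2 := by positivity
  -- The budget, in units of η: for h², 8 · 0.757 + 2.2/2 + 8/64 ≤ 8; for G², 8 · 0.0004 + 0.003/2 +
  -- 1/4 ≤ 1/2, where 1/4 pays for the contraction of F; for q², 8 · 7 = 56.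
  nlinarith

/-- Before any reordering the discrepancy is only bounded by n times the spread. The factor κ ≤ 1/32
makes even this harmless, and smoothness bounds G² by 2LF. -/
theorem potential_init {F G D h σ η κ L : ℝ} (hκ : κ ≤ 1 / 32)
    (hκη : κ = η * L) (hL : 0 < L) (hG : 0 ≤ G) (hD : 0 ≤ D) (hh : 0 ≤ h) (hσ : 0 ≤ σ)
    (e3 : D ≤ h + κ * (G + D)) (e4 : h ≤ κ * (σ + 2 * D)) (hGF : G ^ 2 ≤ 2 * L * F) (hF : 0 ≤ F) :
    F + 8 * η * h ^ 2 ≤ 2 * (F + σ ^ 2 / L) := by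
  have k1 : κ * (G + D) ≤ 1 / 32 * (G + D) := by gcongr
  have k2 : κ * (σ + 2 * D) ≤ 1 / 32 * (σ + 2 * D) := by gcongr
  have l1 : h ≤ 0.04 * σ + 0.004 * G := by linarith
  have s1 : h ^ 2 ≤ (0.04 * σ + 0.004 * G) ^ 2 := pow_le_pow_left₀ hh l1 2
  have s2 : h ^ 2 ≤ σ ^ 2 + 0.1 * G ^ 2 := by nlinarith [sq_nonneg (σ - G)]
  have hηL : 8 * η ≤ 1 / L := by
    rw [le_div_iff₀ hL]; linarith
  have t1 : 8 * η * h ^ 2 ≤ 1 / L * (σ ^ 2 + 0.1 * (2 * L * F)) := by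
    gcongr
    linarith
  have e : 1 / L * (σ ^ 2 + 0.1 * (2 * L * F)) = σ ^ 2 / L + 0.2 * F := by field_simp; ring
  have : 0 ≤ σ ^ 2 / L := by positivity
  linarith

end Recursion

section Trajectory

variable {d n : ℕ} (f : Fin n → EuclideanSpace ℝ (Fin d) → ℝ) (α : ℝ)

/-- The spread of a list of points around its mean. -/
noncomputable def spread (xs : List (EuclideanSpace ℝ (Fin d))) : ℝ :=
  ⨆ i : Fin xs.length, ‖xs.get i - mean xs‖

theorem norm_sub_mean_le_spread (xs : List (EuclideanSpace ℝ (Fin d))) (i : Fin xs.length) :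
    ‖xs.get i - mean xs‖ ≤ spread xs :=
  le_ciSup (f := fun i : Fin xs.length => ‖xs.get i - mean xs‖) (Set.finite_range _).bddAbove i

theorem spread_nonneg (xs : List (EuclideanSpace ℝ (Fin d))) : 0 ≤ spread xs :=
  Real.iSup_nonneg fun _ => norm_nonneg _

theorem spread_map_le (l : List (Fin n)) (g : Fin n → EuclideanSpace ℝ (Fin d)) {B : ℝ}
    (hB : 0 ≤ B) (h : ∀ i, ‖g i - mean (l.map g)‖ ≤ B) : spread (l.map g) ≤ B :=
  Real.iSup_le (fun i => by rw [List.get_eq_getElem, List.getElem_map]; exact h _) hB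

/-- The rank parameter of the epoch that starts in the state `s`. -/
noncomputable def epochRank (K : ℕ) (s : EuclideanSpace ℝ (Fin d) × List (Fin n)) : ℕ :=
  epsRank (epsLevel K (stochGrads f α s.1 s.2)) (colMatrix (stochGrads f α s.1 s.2))

/-- The state `s'` arises from `s` by an epoch of SGD and a reordering along which the signed sums
are well balanced. -/
def BalancedStep (σ : ℝ) (K : ℕ) (s s' : EuclideanSpace ℝ (Fin d) × List (Fin n)) : Prop :=
  s'.1 = sgdEpoch f α s.1 s.2 ∧ ∃ sel, s'.2 = reorder s.2 sel ∧
    HalvingWalk (fun ψ => ‖ψ‖ ≤ walkRadius n K (epochRank f α K s) *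
      (spread (stochGrads f α s.1 s.2) + σ)) 0 (stochGrads f α s.1 s.2) sel

variable {f α}

theorem BalancedStep.perm {σ : ℝ} {K : ℕ} {s s' : EuclideanSpace ℝ (Fin d) × List (Fin n)}
    (h : BalancedStep f α σ K s s') (hs : s.2.Perm (List.finRange n)) :
    s'.2.Perm (List.finRange n) := by
  obtain ⟨-, sel, h, hw⟩ := h
  rw [h]
  exact (reorder_perm (by rw [← hw.length_eq, stochGrads_length])).trans hs

theorem walkRadius_mono (n K : ℕ) {r r' : ℕ} (h : r ≤ r') :
    walkRadius n K r ≤ walkRadius n K r' := by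
  unfold walkRadius
  gcongr

variable (f α) in
/-- The Lyapunov function: suboptimality plus the rescaled squared discrepancy. -/
noncomputable def potential (L : ℝ) (s : EuclideanSpace ℝ (Fin d) × List (Fin n)) : ℝ :=
  risk f s.1 - (⨅ v, risk f v) +
    8 * (α * n) * (α * L * discrepancy (stochGrads f α s.1 s.2)) ^ 2

theorem potential_next_le (hn : 0 < n) (hf : ∀ i, Differentiable ℝ (f i)) {L σ μ : ℝ}
    (hL0 : 0 ≤ L) (hα : 0 ≤ α) (hσ0 : 0 ≤ σ) (hμ : 0 < μ) (hαL : α * n * L ≤ 1 / 32)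
    (hαμ : α * n * μ / 2 ≤ 1 / 64)
    (hσ : ∀ i w, ‖∇ (f i) w - ∇ (risk f) w‖ ≤ σ)
    (hL : ∀ i w v, ‖∇ (f i) w - ∇ (f i) v‖ ≤ L * ‖w - v‖)
    (hPL : ∀ w, risk f w - (⨅ v, risk f v) ≤ 1 / (2 * μ) * ‖∇ (risk f) w‖ ^ 2)
    {s s' : EuclideanSpace ℝ (Fin d) × List (Fin n)} (hs : s.2.Perm (List.finRange n)) {K r : ℕ}
    (hr : epochRank f α K s ≤ r) (h : BalancedStep f α σ K s s') :
    potential f α L s' ≤ (1 - α * n * μ / 2) * potential f α L s +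
      56 * (α * n) * (α * L * walkRadius n K r * σ) ^ 2 := by
  have hs' := h.perm hs
  obtain ⟨hw, sel, hπ, hwalk⟩ := h
  have hdisc := discrepancy_next_le hn hf hL0 hα hσ hL hs hw hπ hwalk
  obtain ⟨g, hg, -, hmean, hdrift, hspread, hend, hend'⟩ := epoch_bounds hn hf hL0 hα hσ hL s hs
  obtain ⟨g', hg', -, -, hdrift', -⟩ := epoch_bounds hn hf hL0 hα hσ hL s' hs'
  have hD0 := drift_nonneg f α s
  have hD0' := drift_nonneg f α s'
  have hdesc := risk_sgdEpoch_le hn hf hα (hαL.trans (by norm_num)) hL hmean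
  rw [← hend, ← hw] at hdesc
  rw [hg] at hspread
  have hsp := spread_map_le s.2 g (by positivity) hspread
  rw [← hg] at hsp
  have hA0 := walkRadius_nonneg n K r
  have hAn : walkRadius n K r ≤ n := min_le_left _ _
  have hS : walkRadius n K (epochRank f α K s) * (spread (stochGrads f α s.1 s.2) + σ) ≤
      walkRadius n K r * (2 * σ + 2 * (L * drift f α s)) := by
    refine mul_le_mul (walkRadius_mono n K hr) (by linarith)
      (add_nonneg (spread_nonneg _) hσ0) hA0
  -- The cap n in `walkRadius` is used here: the drift part of the spread is multiplied by at most
  -- αnL, whatever the rank.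
  have hκ : α * L * walkRadius n K r ≤ α * n * L := by
    have := mul_le_mul_of_nonneg_left hAn (by positivity : 0 ≤ α * L)
    linarith
  unfold potential
  have hG' : ‖∇ (risk f) s'.1‖ ≤ ‖∇ (risk f) s.1‖ + L * drift f α s := by
    have e : ∇ (risk f) s'.1 = ∇ (risk f) s.1 + (∇ (risk f) s'.1 - ∇ (risk f) s.1) := by abel
    rw [e]
    refine (norm_add_le _ _).trans ?_
    have := (lipschitz_gradient_risk hn hf hL s'.1 s.1).trans
      (mul_le_mul_of_nonneg_left (hw ▸ hend') hL0)
    linarith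
  refine potential_step (G := ‖∇ (risk f) s.1‖) (G' := ‖∇ (risk f) s'.1‖) (D := L * drift f α s)
    (D' := L * drift f α s') (κ := α * n * L)
    (s := α * L * (walkRadius n K (epochRank f α K s) * (spread (stochGrads f α s.1 s.2) + σ)))
    (by positivity) hαL (norm_nonneg _) (by positivity) (by positivity)
    (norm_nonneg _) ?_ ?_ (by positivity) hαμ ?_ ?_ hG' ?_ ?_ ?_ (hPL _) hμ
  · exact mul_nonneg (by positivity) (discrepancy_nonneg _)
  · exact mul_nonneg (by positivity) (discrepancy_nonneg _)
  · have := mul_le_mul_of_nonneg_left hdrift hL0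
    linarith
  · have := mul_le_mul_of_nonneg_left hdrift' hL0
    linarith
  · have h1 := mul_le_mul_of_nonneg_left hS (by positivity : 0 ≤ α * L)
    have h2 := mul_le_mul_of_nonneg_right hκ (by positivity : 0 ≤ 2 * (L * drift f α s))
    linarith
  · have := mul_le_mul_of_nonneg_left hdisc (by positivity : 0 ≤ α * L)
    linarith
  · linarith

theorem potential_start_le (hn : 0 < n) (hf : ∀ i, Differentiable ℝ (f i)) {L σ : ℝ}
    (hL0 : 0 < L) (hα : 0 ≤ α) (hσ0 : 0 ≤ σ) (hαL : α * n * L ≤ 1 / 32)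
    (hσ : ∀ i w, ‖∇ (f i) w - ∇ (risk f) w‖ ≤ σ)
    (hL : ∀ i w v, ‖∇ (f i) w - ∇ (f i) v‖ ≤ L * ‖w - v‖)
    (hbdd : BddBelow (Set.range (risk f)))
    {s : EuclideanSpace ℝ (Fin d) × List (Fin n)} (hs : s.2.Perm (List.finRange n)) :
    potential f α L s ≤ 2 * (risk f s.1 - (⨅ v, risk f v) + σ ^ 2 / L) := by
  obtain ⟨g, hg, -, -, hdrift, hspread, -⟩ := epoch_bounds hn hf hL0.le hα hσ hL s hs
  have hD0 := drift_nonneg f α s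
  have hdisc : discrepancy (stochGrads f α s.1 s.2) ≤ n * (σ + 2 * (L * drift f α s)) := by
    refine prefixSup_le fun l hl => ?_
    rw [hg] at hl
    obtain ⟨p, hp, rfl⟩ := List.prefix_map_iff.1 hl
    have hpn : (p.length : ℝ) ≤ n := by
      have := hp.length_le
      rw [hs.length_eq, List.length_finRange] at this
      exact_mod_cast this
    rw [List.map_map]
    exact (norm_sum_map_le p hspread).trans (mul_le_mul_of_nonneg_right hpn (by positivity))
  unfold potential
  refine potential_init (G := ‖∇ (risk f) s.1‖) (D := L * drift f α s) (κ := α * n * L)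
    hαL rfl hL0 (norm_nonneg _) (by positivity) ?_ hσ0 ?_ ?_
    (norm_gradient_sq_le (differentiable_risk hf) hL0 (lipschitz_gradient_risk hn hf hL)
      (fun v => ciInf_le hbdd v) s.1) (sub_nonneg.2 (ciInf_le hbdd _))
  · exact mul_nonneg (by positivity) (discrepancy_nonneg _)
  · have := mul_le_mul_of_nonneg_left hdrift hL0.le
    linarith
  · have := mul_le_mul_of_nonneg_left hdisc (by positivity : 0 ≤ α * L)
    linarith

/-- The suboptimality along a trajectory of balanced steps. -/
theorem suboptimality_le (hn : 0 < n) (hf : ∀ i, Differentiable ℝ (f i)) {L σ μ : ℝ}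
    (hL0 : 0 < L) (hα : 0 ≤ α) (hσ0 : 0 ≤ σ) (hμ : 0 < μ) (hαL : α * n * L ≤ 1 / 32)
    (hαμ : α * n * μ / 2 ≤ 1 / 64)
    (hσ : ∀ i w, ‖∇ (f i) w - ∇ (risk f) w‖ ≤ σ)
    (hL : ∀ i w v, ‖∇ (f i) w - ∇ (f i) v‖ ≤ L * ‖w - v‖)
    (hbdd : BddBelow (Set.range (risk f)))
    (hPL : ∀ w, risk f w - (⨅ v, risk f v) ≤ 1 / (2 * μ) * ‖∇ (risk f) w‖ ^ 2)
    {K : ℕ} (tr : Fin K → EuclideanSpace ℝ (Fin d) × List (Fin n))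
    (htr : ∀ k (hk : k + 1 < K),
      BalancedStep f α σ K (tr ⟨k, Nat.lt_of_succ_lt hk⟩) (tr ⟨k + 1, hk⟩))
    (hK : 0 < K) (h0 : (tr ⟨0, hK⟩).2.Perm (List.finRange n)) (k : ℕ) (hk : k < K) :
    (tr ⟨k, hk⟩).2.Perm (List.finRange n) ∧
    potential f α L (tr ⟨k, hk⟩) ≤ (1 - α * n * μ / 2) ^ k *
      (2 * (risk f (tr ⟨0, hK⟩).1 - (⨅ v, risk f v) + σ ^ 2 / L)) +
      112 * (α * L * walkRadius n K (rankParam f α tr) * σ) ^ 2 / μ := by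
  induction k with
  | zero =>
    refine ⟨h0, (potential_start_le hn hf hL0 hα hσ0 hαL hσ hL hbdd h0).trans ?_⟩
    rw [pow_zero, one_mul]
    exact le_add_of_nonneg_right (by positivity)
  | succ k ih =>
    obtain ⟨hperm, hpot⟩ := ih (Nat.lt_of_succ_lt hk)
    have hr : epochRank f α K (tr ⟨k, Nat.lt_of_succ_lt hk⟩) ≤ rankParam f α tr :=
      Finset.le_sup (f := fun k : Fin K => epochRank f α K (tr k)) (Finset.mem_univ _)
    refine ⟨(htr k hk).perm hperm, ?_⟩
    have h1 := potential_next_le hn hf hL0.le hα hσ0 hμ hαL hαμ hσ hL hPL hperm hr (htr k hk)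
    have h2 := mul_le_mul_of_nonneg_left hpot (by linarith : 0 ≤ 1 - α * n * μ / 2)
    -- The additive constant is the fixed point of the recursion: 56αn divided by αnμ/2 is 112/μ.
    refine (h1.trans (add_le_add_left h2 _)).trans (le_of_eq ?_)
    field_simp
    ring

end Trajectory

end LKHSGD

/-! ### Probability that all epochs are balanced. -/

namespace LKHSGD

section Probability

variable {d n : ℕ} {f : Fin n → EuclideanSpace ℝ (Fin d) → ℝ} {α : ℝ}

/-- A union bound by induction over the epochs. Balance is measured with the rank of the epoch
actually reached, so the random rank parameter needs no conditioning. -/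
theorem lkhSGD_not_balanced_le {K : ℕ} (hK : 1 ≤ K) (hn : 2 ≤ n) (hn2 : Even n)
    (hlog : 2 ≤ Real.log (n * K)) {σ : ℝ} (hσ : 0 < σ) (m : ℕ)
    (s : EuclideanSpace ℝ (Fin d) × List (Fin n)) (hs : s.2.Perm (List.finRange n)) :
    (lkhSGD f α (1 / (2 * (K : ℝ))) m s).toOuterMeasure
      {tr | ¬ ((∀ h : 0 < m, tr ⟨0, h⟩ = s) ∧ ∀ k (hk : k + 1 < m),
        BalancedStep f α σ K (tr ⟨k, Nat.lt_of_succ_lt hk⟩) (tr ⟨k + 1, hk⟩))} ≤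
      m * ENNReal.ofReal (1 / (2 * (K : ℝ))) := by
  induction m generalizing s with
  | zero =>
    simp
  | succ m ih =>
    set δ := ENNReal.ofReal (1 / (2 * (K : ℝ))) with hδ
    set xs := stochGrads f α s.1 s.2 with hxs
    have hlen : xs.length = n := by
      rw [hxs, stochGrads_length, hs.length_eq, List.length_finRange]
    set W : Set (List Bool) := {sel | ¬ HalvingWalk (fun ψ => ‖ψ‖ ≤
      walkRadius n K (epochRank f α K s) * (spread xs + σ)) 0 xs sel} with hW
    have hwalk : (lkh (1 / (2 * (K : ℝ))) xs).toOuterMeasure W ≤ δ := by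
      -- Adding σ to the spread keeps the radius positive when all gradients coincide.
      have h : (lkh (1 / (2 * (K : ℝ))) xs).toOuterMeasure {sel | ¬ HalvingWalk (fun ψ => ‖ψ‖ ≤
          walkRadius xs.length K (epochRank f α K s) * (spread xs + σ)) 0 xs sel} ≤ δ :=
        lkh_walk_bound hK xs (by rwa [hlen]) (by rwa [hlen]) (by rwa [hlen])
        (M := spread xs + σ) (by linarith [spread_nonneg xs])
        (fun i => (norm_sub_mean_le_spread xs i).trans (by linarith))
      rw [hlen] at h
      exact h
    rw [lkhSGD, PMF.toOuterMeasure_bind_apply]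
    calc _ ≤ ∑' sel, (W.indicator (lkh (1 / (2 * (K : ℝ))) xs) sel +
          lkh (1 / (2 * (K : ℝ))) xs sel * (m * δ)) := by
          refine ENNReal.tsum_le_tsum fun sel => ?_
          by_cases hsel : sel ∈ W
          · rw [Set.indicator_of_mem hsel]
            refine le_add_right ?_
            exact (mul_le_mul_right (toOuterMeasure_le_one _ _) _).trans_eq (mul_one _)
          · rw [Set.indicator_of_notMem hsel, zero_add]
            refine mul_le_mul_right ?_ _
            rw [PMF.toOuterMeasure_map_apply]
            have hsel' := not_not.1 hsel
            have hstep : BalancedStep f α σ K s (sgdEpoch f α s.1 s.2, reorder s.2 sel) :=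
              ⟨rfl, sel, rfl, hsel'⟩
            refine le_trans (MeasureTheory.measure_mono ?_) (ih _ (hstep.perm hs))
            intro tr htr hgood
            refine htr ⟨fun _ => rfl, fun k hk => ?_⟩
            rcases k with - | k
            · have := hgood.1 (by omega)
              change BalancedStep f α σ K s (tr ⟨0, _⟩)
              rw [this]
              exact hstep
            · exact hgood.2 k (by omega)
      _ = (lkh (1 / (2 * (K : ℝ))) xs).toOuterMeasure W + m * δ := by
          rw [ENNReal.tsum_add, ENNReal.tsum_mul_right, PMF.tsum_coe, one_mul,
            PMF.toOuterMeasure_apply]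
      _ ≤ δ + m * δ := by gcongr
      _ = ((m + 1 : ℕ) : ENNReal) * δ := by push_cast; ring

theorem half_le_lkhSGD_balanced {K : ℕ} (hK : 1 ≤ K) (hn : 2 ≤ n) (hn2 : Even n)
    (hlog : 2 ≤ Real.log (n * K)) {σ : ℝ} (hσ : 0 < σ)
    (s : EuclideanSpace ℝ (Fin d) × List (Fin n)) (hs : s.2.Perm (List.finRange n)) :
    1 / 2 ≤ (lkhSGD f α (1 / (2 * (K : ℝ))) K s).toOuterMeasure
      {tr | (∀ h : 0 < K, tr ⟨0, h⟩ = s) ∧ ∀ k (hk : k + 1 < K),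
        BalancedStep f α σ K (tr ⟨k, Nat.lt_of_succ_lt hk⟩) (tr ⟨k + 1, hk⟩)} := by
  set p := lkhSGD f α (1 / (2 * (K : ℝ))) K s
  set A := {tr : Fin K → EuclideanSpace ℝ (Fin d) × List (Fin n) |
    (∀ h : 0 < K, tr ⟨0, h⟩ = s) ∧ ∀ k (hk : k + 1 < K),
      BalancedStep f α σ K (tr ⟨k, Nat.lt_of_succ_lt hk⟩) (tr ⟨k + 1, hk⟩)} with hA
  have hbad : p.toOuterMeasure Aᶜ ≤ 1 / 2 := by
    refine (lkhSGD_not_balanced_le (f := f) (α := α) hK hn hn2 hlog hσ K s hs).trans_eq ?_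
    have hK0 : (0 : ℝ) < K := by exact_mod_cast hK
    rw [← ENNReal.ofReal_natCast, ← ENNReal.ofReal_mul hK0.le,
      show (K : ℝ) * (1 / (2 * K)) = 1 / 2 by field_simp,
      ENNReal.ofReal_div_of_pos two_pos]
    simp
  have htot : 1 ≤ p.toOuterMeasure A + p.toOuterMeasure Aᶜ := by
    have h1 : p.toOuterMeasure Set.univ = 1 := by
      rw [PMF.toOuterMeasure_apply, Set.indicator_univ, p.tsum_coe]
    rw [← h1, ← Set.union_compl_self A]
    exact MeasureTheory.measure_union_le _ _
  have h2 : 1 ≤ p.toOuterMeasure A + 1 / 2 := htot.trans (by gcongr)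
  have h3 : (1 : ENNReal) - 1 / 2 ≤ p.toOuterMeasure A := tsub_le_iff_right.2 h2
  rwa [one_div, ENNReal.one_sub_inv_two, ← one_div] at h3

end Probability

/-! ### The Lambert W function and the size of the discrepancy constant. -/

section Lambert

theorem lambertW0_bddAbove (x : ℝ) : BddAbove {y : ℝ | y * Real.exp y ≤ x} := by
  refine ⟨max 1 x, fun y hy => ?_⟩
  by_contra! h
  obtain ⟨h1, h2⟩ := max_lt_iff.1 h
  have : (1 : ℝ) ≤ Real.exp y := Real.one_le_exp (by linarith)
  have : y * 1 ≤ y * Real.exp y := by gcongr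
  have hy' : y * Real.exp y ≤ x := hy
  linarith

theorem lambertW0_nonneg {x : ℝ} (hx : 0 ≤ x) : 0 ≤ lambertW0 x :=
  le_csSup (lambertW0_bddAbove x) (by simpa using hx)

/-- Points to the right of the supremum violate the defining inequality; by continuity the reverse
one passes to the limit. -/
theorem le_lambertW0_mul_exp (x : ℝ) : x ≤ lambertW0 x * Real.exp (lambertW0 x) := by
  have hc : Continuous fun y : ℝ => y * Real.exp y := by fun_prop
  have ht : Filter.Tendsto (fun y : ℝ => y * Real.exp y)
      (nhdsWithin (lambertW0 x) (Set.Ioi (lambertW0 x)))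
      (nhds (lambertW0 x * Real.exp (lambertW0 x))) :=
    (hc.tendsto _).mono_left nhdsWithin_le_nhds
  refine ge_of_tendsto ht ?_
  filter_upwards [self_mem_nhdsWithin] with y hy
  by_contra! h
  exact absurd (le_csSup (lambertW0_bddAbove x) (show y ∈ _ from h.le)) (not_le.2 hy)

theorem lambertW0_le {x c : ℝ} (hx : 0 ≤ x) (hxc : x ≤ Real.exp c) (hc : 1 ≤ c) :
    lambertW0 x ≤ c := by
  refine csSup_le ⟨0, by simpa using hx⟩ fun y hy => ?_
  by_contra! h
  have h1 : Real.exp c < Real.exp y := Real.exp_lt_exp.2 h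
  have h2 : 1 * Real.exp y ≤ y * Real.exp y := by gcongr; linarith
  have hy' : y * Real.exp y ≤ x := hy
  linarith

end Lambert

section Constants

theorem discConst_sq_le {n K ρ : ℕ} (hn : 2 ≤ n) (hK : 1 ≤ K) (hlog : 2 ≤ Real.log (n * K)) :
    discConst n K ρ ^ 2 ≤ 512 * Real.log (n * K) ^ 2 * (max ρ 1 : ℕ) := by
  have h1 : (1 : ℝ) ≤ K := by exact_mod_cast hK
  have h2 : (2 : ℝ) ≤ n := by exact_mod_cast hn
  have hle : Real.log (n / 2) + 1 ≤ n / 2 := log_div_two_add_one_le hn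
  have hlog0 : 0 ≤ Real.log ((n : ℝ) / 2) := Real.log_nonneg (by linarith)
  have hKn : 1 ≤ 4 * (K : ℝ) * n := by nlinarith
  have l1 : Real.log (4 * K * n * (Real.log (n / 2) + 1)) ≤ 4 * Real.log (n * K) := by
    refine log_const_mul_le (by positivity) hn hK hlog ?_
    have := mul_le_mul_of_nonneg_left hle (by positivity : (0 : ℝ) ≤ 4 * K * n)
    have : (0 : ℝ) ≤ K * (n : ℝ) ^ 2 := by positivity
    nlinarith
  have l2 : Real.log (4 * K * n) ≤ 4 * Real.log (n * K) := by
    refine log_const_mul_le (by positivity) hn hK hlog ?_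
    nlinarith [mul_nonneg (by positivity : (0 : ℝ) ≤ K * n) (by linarith : (0 : ℝ) ≤ n - 1)]
  have l20 : 0 ≤ Real.log (4 * K * n) := Real.log_nonneg hKn
  have l10 : 0 ≤ Real.log (4 * K * n * (Real.log (n / 2) + 1)) :=
    Real.log_nonneg (by nlinarith)
  have he := Real.exp_one_lt_d9
  have he0 := Real.exp_pos 1
  have hρ : (ρ : ℝ) ≤ (max ρ 1 : ℕ) := by exact_mod_cast le_max_left _ _
  have hρ1 : (1 : ℝ) ≤ (max ρ 1 : ℕ) := by exact_mod_cast le_max_right _ _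
  set R : ℝ := ((max ρ 1 : ℕ) : ℝ)
  set ℓ := Real.log (n * K)
  rw [discConst, Real.sq_sqrt (by positivity)]
  have hb : Real.exp 1 ^ 2 * ρ + 10 * Real.exp 1 * Real.log (4 * K * n) ≤ 128 * ℓ * R := by
    have b1 : Real.exp 1 ^ 2 * ρ ≤ 8 * R := by
      gcongr
      nlinarith
    have b2 : 10 * Real.exp 1 * Real.log (4 * K * n) ≤ 28 * (4 * ℓ) := by
      gcongr
      linarith
    have b3 : 2 * R ≤ ℓ * R := by gcongr
    have b4 : ℓ * 1 ≤ ℓ * R := by gcongr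
    linarith
  calc _ ≤ 4 * ℓ * (128 * ℓ * R) := by gcongr
    _ = 512 * ℓ ^ 2 * R := by ring

theorem one_le_discConst_sq {n K ρ : ℕ} (hn : 2 ≤ n) (hK : 1 ≤ K) :
    1 ≤ discConst n K ρ ^ 2 := by
  have h1 : (1 : ℝ) ≤ K := by exact_mod_cast hK
  have h2 : (2 : ℝ) ≤ n := by exact_mod_cast hn
  have hlog0 : 0 ≤ Real.log ((n : ℝ) / 2) := Real.log_nonneg (by linarith)
  have hKn : 8 ≤ 4 * (K : ℝ) * n := by nlinarith
  have he := Real.exp_one_lt_d9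
  have l2 : 1 ≤ Real.log (4 * K * n) := by
    rw [Real.le_log_iff_exp_le (by linarith)]
    linarith
  have l1 : 1 ≤ Real.log (4 * K * n * (Real.log (n / 2) + 1)) := by
    rw [Real.le_log_iff_exp_le (by positivity)]
    nlinarith
  rw [discConst, Real.sq_sqrt (by positivity)]
  have he1 : 1 ≤ Real.exp 1 := Real.one_le_exp zero_le_one
  have b1 : 0 ≤ Real.exp 1 ^ 2 * ρ := by positivity
  have b2 : 1 ≤ 10 * Real.exp 1 * Real.log (4 * K * n) := by nlinarith
  nlinarith

theorem discConst_nonneg (n K ρ : ℕ) : 0 ≤ discConst n K ρ := Real.sqrt_nonneg _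

end Constants

end LKHSGD

/-! ### The final rate. -/

namespace LKHSGD

/-- The contraction over the run is of order e^{-W}, and x ≤ W e^W converts e^{-W} into the rate.
The initial error thus contributes ℓ · ℓ² and the noise ℓ² · ℓ², whence the exponent 4. -/
theorem rate_le {L σ μ Q' W c ℓ N A B R V : ℝ} {K : ℕ} (hL : 0 < L) (hσ : 0 < σ) (hμ : 0 < μ)
    (hQ : 0 < Q') (hK : 1 ≤ K) (hN : 0 < N) (hW0 : 0 ≤ W) (hW : W ≤ c * ℓ) (hc : 0 ≤ c)
    (hℓ : 1 ≤ ℓ) (hA0 : 0 < A) (hA : A ≤ 512 * ℓ ^ 2 * R) (hR : 0 ≤ R)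
    (hB : B ^ 2 ≤ 1440 * ℓ ^ 2 * R) (hWK : W / K ≤ 1 / 64)
    (hx : (K : ℝ) ^ 2 * N ^ 2 * (Q' * μ ^ 2 / (224 * L ^ 2 * σ ^ 2 * A)) ≤ W * Real.exp W)
    (hV : V ≤ (1 - W / K) ^ (K - 1) * (2 * Q') +
      112 * (2 * W / (K * N * μ) * L * B * σ) ^ 2 / μ) :
    V ≤ (1344 * 512 * c * L ^ 2 * σ ^ 2 / μ ^ 2 + 448 * 1440 * c ^ 2 * L ^ 2 * σ ^ 2 / μ ^ 3) *
      ℓ ^ 4 * R / (N ^ 2 * (K : ℝ) ^ 2) := by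
  have hK0 : (0 : ℝ) < K := by exact_mod_cast hK
  -- The last recorded iterate has seen only K - 1 epochs; the missing factor is at most e^{W/K} ≤
  -- 3.
  have h1 : (1 - W / K) ^ (K - 1) ≤ 3 * Real.exp (-W) := by
    calc (1 - W / K) ^ (K - 1) ≤ Real.exp (-(W / K)) ^ (K - 1) := by
          apply pow_le_pow_left₀ (by linarith)
          linarith [Real.add_one_le_exp (-(W / K))]
      _ = Real.exp (W / K) * Real.exp (-W) := by
          rw [← Real.exp_nat_mul, ← Real.exp_add, Nat.cast_sub hK]
          congr 1
          field_simp
          ring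
      _ ≤ 3 * Real.exp (-W) := by
          gcongr
          have := Real.exp_le_exp.2 (hWK.trans (by norm_num : (1 : ℝ) / 64 ≤ 1))
          linarith [Real.exp_one_lt_d9]
  have h2 : Real.exp (-W) * Q' ≤ W * (224 * L ^ 2 * σ ^ 2 * A) / (K ^ 2 * N ^ 2 * μ ^ 2) := by
    have h3 := mul_le_mul_of_nonneg_right hx (Real.exp_pos (-W)).le
    rw [mul_assoc W, ← Real.exp_add, add_neg_cancel, Real.exp_zero, mul_one] at h3
    rw [le_div_iff₀ (by positivity)]
    have e : (K : ℝ) ^ 2 * N ^ 2 * (Q' * μ ^ 2 / (224 * L ^ 2 * σ ^ 2 * A)) * Real.exp (-W) =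
        Real.exp (-W) * Q' * (K ^ 2 * N ^ 2 * μ ^ 2) / (224 * L ^ 2 * σ ^ 2 * A) := by ring
    rw [e, div_le_iff₀ (by positivity)] at h3
    exact h3
  have t1 : (1 - W / K) ^ (K - 1) * (2 * Q') ≤
      1344 * 512 * c * L ^ 2 * σ ^ 2 / μ ^ 2 * ℓ ^ 4 * R / (N ^ 2 * (K : ℝ) ^ 2) := by
    calc (1 - W / K) ^ (K - 1) * (2 * Q') ≤ 3 * Real.exp (-W) * (2 * Q') := by gcongr
      _ = 6 * (Real.exp (-W) * Q') := by ring
      _ ≤ 6 * (W * (224 * L ^ 2 * σ ^ 2 * A) / (K ^ 2 * N ^ 2 * μ ^ 2)) := by gcongr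
      _ ≤ 6 * ((c * ℓ) * (224 * L ^ 2 * σ ^ 2 * (512 * ℓ ^ 2 * R)) / (K ^ 2 * N ^ 2 * μ ^ 2)) := by
          gcongr
      _ = 1344 * 512 * c * L ^ 2 * σ ^ 2 / μ ^ 2 * ℓ ^ 3 * R / (N ^ 2 * (K : ℝ) ^ 2) := by
          field_simp
          ring
      _ ≤ _ := by
          gcongr
          norm_num
  have t2 : 112 * (2 * W / (K * N * μ) * L * B * σ) ^ 2 / μ ≤
      448 * 1440 * c ^ 2 * L ^ 2 * σ ^ 2 / μ ^ 3 * ℓ ^ 4 * R / (N ^ 2 * (K : ℝ) ^ 2) := by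
    calc 112 * (2 * W / (K * N * μ) * L * B * σ) ^ 2 / μ
        = 448 * L ^ 2 * σ ^ 2 * W ^ 2 * B ^ 2 / (μ ^ 3 * (N ^ 2 * K ^ 2)) := by
          field_simp
          ring
      _ ≤ 448 * L ^ 2 * σ ^ 2 * (c * ℓ) ^ 2 * (1440 * ℓ ^ 2 * R) / (μ ^ 3 * (N ^ 2 * K ^ 2)) := by
          gcongr
      _ = _ := by
          field_simp
  refine (hV.trans (add_le_add t1 t2)).trans (le_of_eq ?_)
  ring

/-- Smoothness gives ‖∇f‖² ≤ 2L(f - f*) and the Polyak–Łojasiewicz inequality ‖∇f‖² ≥ 2μ(f - f*).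
For μ > L these force f = f*. -/
theorem suboptimality_eq_zero_of_lt {d n : ℕ} {f : Fin n → EuclideanSpace ℝ (Fin d) → ℝ}
    (hn : 0 < n) (hf : ∀ i, Differentiable ℝ (f i)) {L μ : ℝ} (hL0 : 0 < L) (hμL : L < μ)
    (hL : ∀ i w v, ‖∇ (f i) w - ∇ (f i) v‖ ≤ L * ‖w - v‖)
    (hbdd : BddBelow (Set.range (risk f)))
    (hPL : ∀ w, risk f w - (⨅ v, risk f v) ≤ 1 / (2 * μ) * ‖∇ (risk f) w‖ ^ 2)
    (w : EuclideanSpace ℝ (Fin d)) : risk f w - (⨅ v, risk f v) ≤ 0 := by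
  have h1 := norm_gradient_sq_le (differentiable_risk hf) hL0 (lipschitz_gradient_risk hn hf hL)
    (fun v => ciInf_le hbdd v) w
  have hμ : 0 < μ := hL0.trans hμL
  have h2 := hPL w
  rw [one_div, inv_mul_eq_div, le_div_iff₀ (by positivity)] at h2
  nlinarith

theorem exp_two_lt_twenty : Real.exp 2 < 20 := by
  have h : Real.exp 2 = Real.exp 1 ^ 2 := by rw [← Real.exp_nat_mul]; norm_num
  rw [h]
  nlinarith [Real.exp_one_lt_d9, Real.exp_pos 1]

end LKHSGD

theorem theorem3 :
    ∃ p : ℕ, ∀ L σ μ F₁ : ℝ, 0 < L → 0 < σ → 0 < μ →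
      ∃ C : ℝ, 0 < C ∧
        ∀ (d n K : ℕ) (_hn : Even n) (_hn0 : 0 < n) (hK : 0 < K)
          (f : Fin n → EuclideanSpace ℝ (Fin d) → ℝ)
          (w₁ : EuclideanSpace ℝ (Fin d)) (π₁ : Equiv.Perm (Fin n)) (ρ : ℕ),
          (∀ i, Differentiable ℝ (f i)) →
          (∀ i w, ‖gradient (f i) w - gradient (LKHSGD.risk f) w‖ ^ 2 ≤ σ ^ 2) →
          (∀ i w v, ‖gradient (f i) w - gradient (f i) v‖ ≤ L * ‖w - v‖) →
          BddBelow (Set.range (LKHSGD.risk f)) →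
          (∀ w, LKHSGD.risk f w - (⨅ v, LKHSGD.risk f v) ≤
            1 / (2 * μ) * ‖gradient (LKHSGD.risk f) w‖ ^ 2) →
          LKHSGD.risk f w₁ - (⨅ v, LKHSGD.risk f v) = F₁ →
          (K : ℝ) ≥ 10 + 1 / μ * (32 * L * (2 + LKHSGD.discConst n K ρ / n) *
            LKHSGD.tildeW L σ μ F₁ n K ρ) →
          1 / 2 ≤
            (LKHSGD.lkhSGD f (LKHSGD.stepSize L σ μ F₁ n K ρ) (1 / (2 * (K : ℝ))) K
                (w₁, List.ofFn π₁)).toOuterMeasure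
              {tr | LKHSGD.risk f (tr ⟨K - 1, Nat.sub_lt hK one_pos⟩).1
                    - (⨅ v, LKHSGD.risk f v) ≤
                  C * Real.log (n * K) ^ p *
                    (max (max (LKHSGD.rankParam f (LKHSGD.stepSize L σ μ F₁ n K ρ) tr) ρ) 1 : ℕ)
                    / ((n : ℝ) ^ 2 * (K : ℝ) ^ 2)} := by
  open LKHSGD in
  refine ⟨4, fun L σ μ F₁ hL hσ hμ => ?_⟩
  set Q : ℝ := (F₁ + σ ^ 2 / L) * μ ^ 2 / (224 * L ^ 2 * σ ^ 2) with hQ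
  -- Chosen so that W ≤ c log(nK). The absolute value is there because C is fixed before F₁ is known
  -- to be nonnegative.
  set c : ℝ := 3 + Real.log (1 + |Q|) with hc
  have hlogQ : 0 ≤ Real.log (1 + |Q|) := Real.log_nonneg (by linarith [abs_nonneg Q])
  have hc0 : 0 < c := by linarith
  refine ⟨1344 * 512 * c * L ^ 2 * σ ^ 2 / μ ^ 2 + 448 * 1440 * c ^ 2 * L ^ 2 * σ ^ 2 / μ ^ 3,
    by positivity, ?_⟩
  intro d n K hn hn0 hK f w₁ π₁ ρ hf hvar hlip hbdd hPL hF hKge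
  have hn2 : 2 ≤ n := by
    obtain ⟨m, rfl⟩ := hn
    omega
  have hn' : (2 : ℝ) ≤ n := by exact_mod_cast hn2
  have hK0 : (0 : ℝ) < K := by exact_mod_cast hK
  have hF0 : 0 ≤ F₁ := hF ▸ sub_nonneg.2 (ciInf_le hbdd _)
  have hQ' : 0 < F₁ + σ ^ 2 / L := by positivity
  have hA1 := one_le_discConst_sq (ρ := ρ) hn2 hK
  have hA0 : 0 < discConst n K ρ ^ 2 := by linarith
  set A := discConst n K ρ with hA
  set x : ℝ := (K : ℝ) ^ 2 * (n : ℝ) ^ 2 *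
    ((F₁ + σ ^ 2 / L) * μ ^ 2 / (224 * L ^ 2 * σ ^ 2 * A ^ 2)) with hx
  have hx0 : 0 < x := by positivity
  set W := tildeW L σ μ F₁ n K ρ with hW
  have hWx : W = lambertW0 x := rfl
  have hW0 : 0 ≤ W := hWx ▸ lambertW0_nonneg hx0.le
  have hAn : 0 ≤ A / n := div_nonneg (discConst_nonneg _ _ _) (by linarith)
  -- The part of the epoch condition without the discrepancy constant suffices: it is exactly what
  -- gives αnL ≤ 1/32.
  have hstep : 10 + 1 / μ * (64 * L * W) ≤ K := by
    refine le_trans ?_ hKge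
    have : 64 * L * W ≤ 32 * L * (2 + A / n) * W := by
      have := mul_le_mul_of_nonneg_left hAn (by positivity : 0 ≤ 32 * L * W)
      linarith
    gcongr
  have hK10 : (10 : ℝ) ≤ K := by
    have : 0 ≤ 1 / μ * (64 * L * W) := by positivity
    linarith
  have hnK : (20 : ℝ) ≤ n * K := by nlinarith
  have hlog : 2 ≤ Real.log (n * K) := by
    rw [Real.le_log_iff_exp_le (by linarith)]
    linarith [exp_two_lt_twenty]
  have hα0 : 0 ≤ stepSize L σ μ F₁ n K ρ := by
    rw [stepSize]; positivity
  have hαL : stepSize L σ μ F₁ n K ρ * n * L ≤ 1 / 32 := by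
    have e : stepSize L σ μ F₁ n K ρ * n * L = (1 / μ * (64 * L * W)) / K / 32 := by
      rw [stepSize, ← hW]
      field_simp
      ring
    rw [e]
    have : (1 / μ * (64 * L * W)) / K ≤ 1 := by
      rw [div_le_one hK0]; linarith
    linarith
  have hαμ : stepSize L σ μ F₁ n K ρ * n * μ / 2 = W / K := by
    rw [stepSize, ← hW]
    field_simp
  have hvar' : ∀ i w, ‖gradient (f i) w - gradient (risk f) w‖ ≤ σ := fun i w =>
    (abs_le_of_sq_le_sq' (hvar i w) hσ.le).2
  have hperm : (List.ofFn π₁).Perm (List.finRange n) := by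
    rw [List.ofFn_eq_map]
    exact Equiv.Perm.map_finRange_perm π₁
  refine (half_le_lkhSGD_balanced hK hn2 hn hlog hσ (w₁, List.ofFn π₁) hperm).trans
    (MeasureTheory.measure_mono ?_)
  rintro tr ⟨htr0, htr⟩
  rw [Set.mem_ofPred_eq]
  -- For μ ≤ L the bound on αnL also yields W/K = αnμ/2 ≤ 1/64; for μ > L the suboptimality
  -- vanishes.
  rcases lt_or_ge L μ with hμL | hμL
  · refine (suboptimality_eq_zero_of_lt hn0 hf hL hμL hlip hbdd hPL _).trans ?_
    positivity
  have hWK : W / K ≤ 1 / 64 := by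
    rw [← hαμ]
    have : stepSize L σ μ F₁ n K ρ * n * μ ≤ stepSize L σ μ F₁ n K ρ * n * L := by gcongr
    linarith
  obtain ⟨-, hpot⟩ := suboptimality_le hn0 hf hL hα0 hσ.le hμ hαL (by rw [hαμ]; exact hWK) hvar'
    hlip hbdd hPL tr htr hK (by rw [htr0 hK]; exact hperm) (K - 1) (Nat.sub_lt hK one_pos)
  rw [htr0 hK, hF, hαμ] at hpot
  set r := rankParam f (stepSize L σ μ F₁ n K ρ) tr with hr
  set R : ℝ := ((max (max r ρ) 1 : ℕ) : ℝ) with hR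
  have hR1 : ((max ρ 1 : ℕ) : ℝ) ≤ R := by
    rw [hR]; exact_mod_cast (by omega)
  have hR2 : ((max r 1 : ℕ) : ℝ) ≤ R := by
    rw [hR]; exact_mod_cast (by omega)
  have hV : risk f (tr ⟨K - 1, Nat.sub_lt hK one_pos⟩).1 - (⨅ v, risk f v) ≤
      potential f (stepSize L σ μ F₁ n K ρ) L (tr ⟨K - 1, Nat.sub_lt hK one_pos⟩) :=
    le_add_of_nonneg_right (by positivity)
  have hWle : W ≤ c * Real.log (n * K) := by
    have h1 : W ≤ 1 + 2 * Real.log (n * K) + Real.log (1 + |Q|) := by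
      rw [hWx]
      apply lambertW0_le hx0.le
      · rw [Real.exp_add, Real.exp_add, Real.exp_log (by positivity),
          show 2 * Real.log ((n : ℝ) * K) = ((2 : ℕ) : ℝ) * Real.log (n * K) by norm_num,
          Real.exp_nat_mul, Real.exp_log (by positivity)]
        have e : x = ((n : ℝ) * K) ^ 2 * (Q / A ^ 2) := by
          rw [hx, hQ]; field_simp
        have hQ0 : 0 < Q := by positivity
        have h2 : Q / A ^ 2 ≤ 1 + |Q| := by
          refine (div_le_self hQ0.le hA1).trans ?_
          linarith [le_abs_self Q]
        have h3 : 1 ≤ Real.exp 1 := Real.one_le_exp zero_le_one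
        rw [e]
        calc ((n : ℝ) * K) ^ 2 * (Q / A ^ 2) ≤ ((n : ℝ) * K) ^ 2 * (1 + |Q|) := by gcongr
          _ = 1 * ((n : ℝ) * K) ^ 2 * (1 + |Q|) := by ring
          _ ≤ _ := by gcongr
      · linarith
    have h2 : Real.log (1 + |Q|) * 1 ≤ Real.log (1 + |Q|) * Real.log (n * K) := by
      gcongr; linarith
    rw [hc]
    linarith
  refine rate_le hL hσ hμ hQ' hK (N := n) (A := A ^ 2) (B := walkRadius n K r) (by linarith) hW0
    hWle hc0.le (by linarith) hA0 ?_ (by positivity) ?_ hWK ?_ (hV.trans hpot)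
  · refine (discConst_sq_le hn2 hK hlog).trans ?_
    gcongr
  · have h1 : walkRadius n K r ^ 2 ≤
        √(1440 * Real.log (n * K) ^ 2 * (max r 1 : ℕ)) ^ 2 :=
      pow_le_pow_left₀ (walkRadius_nonneg _ _ _) (min_le_right _ _) 2
    rw [Real.sq_sqrt (by positivity)] at h1
    refine h1.trans ?_
    gcongr
  · rw [hWx]
    exact le_lambertW0_mul_exp x
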